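/- Let $R$ be an associative ring with identity; modules are left $R$-modules. A short exact sequence of modules is *pure exact* if it stays exact after applying $M\otimes_R-$ for every right $R$-module $M$; its two maps are then called *pure monic* and *pure epic*. A module is *pure projective* (resp. *pure injective*) if it is projective (resp. injective) with respect to all pure exact sequences. A cochain complex $X$ of modules is *pure exact at $n$* if each of $d_X^{n-1}$ and $d_X^n$ is a pure epic map followed by a pure monic map and the sequence $0\to\operatorname{Ker}d_X^n\to X^n\to\operatorname{Coker}d_X^{n-1}\to0$ is pure exact; $X$ is *pure exact* if it is so at every $n\in\mathbb Z$. In $\mathbb Z\cup\{\pm\infty\}$ put $$\mathrm{inf_p}X=\inf\{n\in\mathbb Z\mid X\text{ is not pure exact at }n\},\qquad \mathrm{sup_p}X=\sup\{n\in\mathbb Z\mid X\text{ is not pure exact at }n\},$$ with $\inf\varnothing=+\infty$ and $\sup\varnothing=-\infty$. Let $\mathbf K(R)$ be the homotopy category of complexes of modules and $\mathbf K^b(R)$ its full subcategory of bounded complexes. The *bounded pure derived category* $\mathbf D^b_{\mathrm{pur}}(R)$ is the Verdier quotient of $\mathbf K^b(R)$ by the subcategory of bounded pure exact complexes. Let $\mathbf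 K^{-,pb}(\mathcal{PP})$ be the full triangulated subcategory of $\mathbf K(R)$ of the bounded above complexes $X$ of pure projective modules with $\mathrm{inf_p}X>-\infty$, and $\mathbf K^{+,pb}(\mathcal{PI})$ that of the bounded below complexes $X$ of pure injective modules with $\mathrm{sup_p}X<+\infty$. **Theorem.** For every ring $R$ there are equivalences of triangulated categories $$\text{(1)}\quad \mathbf D^b_{\mathrm{pur}}(R)\simeq\mathbf K^{-,pb}(\mathcal{PP}),\qquad\qquad \text{(2)}\quad \mathbf D^b_{\mathrm{pur}}(R)\simeq\mathbf K^{+,pb}(\mathcal{PI}).$$ -/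

import Mathlib

open CategoryTheory Limits Pretriangulated
open scoped TensorProduct ZeroObject

universe u

namespace PureDerived

noncomputable section

variable (R : Type u) [Ring R]

/-- The relations `(m · r) ⊗ a = m ⊗ (r · a)` imposed on `M ⊗[ℤ] A`. Right `R`-modules
are modules over the opposite ring, so `MulOpposite.op r • m` is `m · r`. -/
def balancedRelations (M : ModuleCat.{u} Rᵐᵒᵖ) (A : ModuleCat.{u} R) : AddSubgroup (M ⊗[ℤ] A) :=
  AddSubgroup.closure {t | ∃ (m : M) (r : R) (a : A),
    t = (MulOpposite.op r • m) ⊗ₜ[ℤ] a - m ⊗ₜ[ℤ] (r • a)}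

/-- The tensor product `M ⊗_R A` of a right `R`-module `M` and a left `R`-module `A` over a not
necessarily commutative ring `R`: an abelian group. -/
abbrev BalancedTensor (M : ModuleCat.{u} Rᵐᵒᵖ) (A : ModuleCat.{u} R) : Type u :=
  (M ⊗[ℤ] A) ⧸ balancedRelations R M A

variable {R}

/-- The map `M ⊗[ℤ] A → M ⊗[ℤ] B` induced by an `R`-linear map `A → B`. -/
def intTensorMap (M : ModuleCat.{u} Rᵐᵒᵖ) {A B : ModuleCat.{u} R} (f : A ⟶ B) :
    M ⊗[ℤ] A →+ M ⊗[ℤ] B :=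
  (f.hom.toAddMonoidHom.toIntLinearMap.lTensor M).toAddMonoidHom

@[simp]
lemma intTensorMap_tmul (M : ModuleCat.{u} Rᵐᵒᵖ) {A B : ModuleCat.{u} R} (f : A ⟶ B)
    (m : M) (a : A) : intTensorMap M f (m ⊗ₜ a) = m ⊗ₜ (f.hom a) := rfl

lemma balancedRelations_le_comap (M : ModuleCat.{u} Rᵐᵒᵖ) {A B : ModuleCat.{u} R} (f : A ⟶ B) :
    balancedRelations R M A ≤ (balancedRelations R M B).comap (intTensorMap M f) := by
  rw [balancedRelations, AddSubgroup.closure_le]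
  rintro _ ⟨m, r, a, rfl⟩
  exact AddSubgroup.subset_closure ⟨m, r, f.hom a, by simp⟩

/-- The map `M ⊗_R A → M ⊗_R B` induced by an `R`-linear map `A → B`. -/
def BalancedTensor.map (M : ModuleCat.{u} Rᵐᵒᵖ) {A B : ModuleCat.{u} R} (f : A ⟶ B) :
    BalancedTensor R M A →+ BalancedTensor R M B :=
  QuotientAddGroup.map _ _ (intTensorMap M f) (balancedRelations_le_comap M f)

lemma BalancedTensor.addHom_ext {M : ModuleCat.{u} Rᵐᵒᵖ} {A : ModuleCat.{u} R} {G : Type u}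
    [AddCommGroup G] {f g : BalancedTensor R M A →+ G}
    (h : ∀ (m : M) (a : A), f (QuotientAddGroup.mk (m ⊗ₜ a)) = g (QuotientAddGroup.mk (m ⊗ₜ a))) :
    f = g := by
  ext x
  change f (QuotientAddGroup.mk x) = g (QuotientAddGroup.mk x)
  induction x using TensorProduct.induction_on with
  | zero => rw [QuotientAddGroup.mk_zero, map_zero, map_zero]
  | tmul m a => exact h m a
  | add x y hx hy => rw [QuotientAddGroup.mk_add, map_add, map_add, hx, hy]

/-- The functor `M ⊗_R -` from left `R`-modules to abelian groups. -/
def tensorFunctor (M : ModuleCat.{u} Rᵐᵒᵖ) : ModuleCat.{u} R ⥤ AddCommGrpCat.{u} where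
  obj A := AddCommGrpCat.of (BalancedTensor R M A)
  map f := AddCommGrpCat.ofHom (BalancedTensor.map M f)
  map_id A := by
    ext1
    exact BalancedTensor.addHom_ext fun m a ↦ rfl
  map_comp f g := by
    ext1
    exact BalancedTensor.addHom_ext fun m a ↦ rfl

instance (M : ModuleCat.{u} Rᵐᵒᵖ) : (tensorFunctor M).Additive where
  map_add {A B f g} := by
    ext1
    refine BalancedTensor.addHom_ext fun m a ↦ ?_
    change QuotientAddGroup.mk (m ⊗ₜ (f.hom a + g.hom a)) = QuotientAddGroup.mk (m ⊗ₜ f.hom a) +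
      QuotientAddGroup.mk (m ⊗ₜ g.hom a)
    rw [TensorProduct.tmul_add, QuotientAddGroup.mk_add]

lemma tensorFunctor_map_surjective (M : ModuleCat.{u} Rᵐᵒᵖ) {A B : ModuleCat.{u} R} (f : A ⟶ B)
    (hf : Function.Surjective f) : Function.Surjective ((tensorFunctor M).map f) := by
  intro y
  obtain ⟨y, rfl⟩ := QuotientAddGroup.mk_surjective y
  obtain ⟨x, rfl⟩ := LinearMap.lTensor_surjective M
    (g := f.hom.toAddMonoidHom.toIntLinearMap) hf y
  exact ⟨QuotientAddGroup.mk x, rfl⟩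

lemma tensorFunctor_map_exact (M : ModuleCat.{u} Rᵐᵒᵖ) (S : ShortComplex (ModuleCat.{u} R))
    (hS : S.Exact) (hg : Function.Surjective S.g) (y : (tensorFunctor M).obj S.X₂)
    (hy : (tensorFunctor M).map S.g y = 0) : ∃ x, (tensorFunctor M).map S.f x = y := by
  obtain ⟨y, rfl⟩ := QuotientAddGroup.mk_surjective y
  have h1 : intTensorMap M S.g y ∈ balancedRelations R M S.X₃ :=
    (QuotientAddGroup.eq_zero_iff _).1 hy
  have h2 : balancedRelations R M S.X₃ ≤ (balancedRelations R M S.X₂).map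
      (intTensorMap M S.g) := by
    rw [balancedRelations, AddSubgroup.closure_le]
    rintro _ ⟨m, r, c, rfl⟩
    obtain ⟨b, rfl⟩ := hg c
    exact ⟨_, AddSubgroup.subset_closure ⟨m, r, b, rfl⟩, by simp⟩
  obtain ⟨s, hs, hs'⟩ := h2 h1
  have hex : Function.Exact S.f.hom.toAddMonoidHom.toIntLinearMap
      S.g.hom.toAddMonoidHom.toIntLinearMap :=
    (ShortComplex.ShortExact.moduleCat_exact_iff_function_exact S).1 hS
  have h3 : intTensorMap M S.g (y - s) = 0 := by rw [map_sub, hs', sub_self]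
  obtain ⟨x, hx⟩ := (lTensor_exact M hex hg (y - s)).1 h3
  refine ⟨QuotientAddGroup.mk x, ?_⟩
  change QuotientAddGroup.mk (LinearMap.lTensor M _ x) = QuotientAddGroup.mk y
  rw [hx, QuotientAddGroup.eq]
  have : -(y - s) + y = s := by abel
  rw [this]
  exact hs

/-- A short exact sequence of left `R`-modules is pure exact if it stays exact after
tensoring with any right `R`-module. -/
structure IsPureExact (S : ShortComplex (ModuleCat.{u} R)) : Prop where
  shortExact : S.ShortExact
  tensor (M : ModuleCat.{u} Rᵐᵒᵖ) : (S.map (tensorFunctor M)).ShortExact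

/-- A map is pure monic if it is the first map of a pure exact sequence. -/
def IsPureMono {A B : ModuleCat.{u} R} (f : A ⟶ B) : Prop :=
  ∃ (C : ModuleCat.{u} R) (g : B ⟶ C) (w : f ≫ g = 0), IsPureExact (ShortComplex.mk f g w)

/-- A map is pure epic if it is the second map of a pure exact sequence. -/
def IsPureEpi {B C : ModuleCat.{u} R} (g : B ⟶ C) : Prop :=
  ∃ (A : ModuleCat.{u} R) (f : A ⟶ B) (w : f ≫ g = 0), IsPureExact (ShortComplex.mk f g w)

/-- The map `d` is a pure epimorphism followed by a pure monomorphism. -/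
def HasPureFactorization {A B : ModuleCat.{u} R} (d : A ⟶ B) : Prop :=
  ∃ (D : ModuleCat.{u} R) (p : A ⟶ D) (i : D ⟶ B), IsPureEpi p ∧ IsPureMono i ∧ p ≫ i = d

/-- The complex `X` is pure exact at `n`: the differentials `d^{n-1}` and `d^n` both factor as
a pure epimorphism followed by a pure monomorphism, and the sequence
`0 → Ker d^n → X^n → Coker d^{n-1} → 0` is pure exact. -/
def PureExactAt (X : CochainComplex (ModuleCat.{u} R) ℤ) (n : ℤ) : Prop :=
  HasPureFactorization (X.d (n - 1) n) ∧ HasPureFactorization (X.d n (n + 1)) ∧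
    ∃ w : kernel.ι (X.d n (n + 1)) ≫ cokernel.π (X.d (n - 1) n) = 0,
      IsPureExact (ShortComplex.mk _ _ w)

/-- `inf_p X`: the infimum, in the integers extended by `±∞`, of the set of the degrees at which
`X` is not pure exact. -/
def infPur (X : CochainComplex (ModuleCat.{u} R) ℤ) : WithBot (WithTop ℤ) :=
  sInf {a | ∃ n : ℤ, ¬ PureExactAt X n ∧ a = ((n : WithTop ℤ) : WithBot (WithTop ℤ))}

/-- `sup_p X`: the supremum, in the integers extended by `±∞`, of the set of the degrees at which
`X` is not pure exact. -/
def supPur (X : CochainComplex (ModuleCat.{u} R) ℤ) : WithBot (WithTop ℤ) :=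
  sSup {a | ∃ n : ℤ, ¬ PureExactAt X n ∧ a = ((n : WithTop ℤ) : WithBot (WithTop ℤ))}

lemma infPur_ne_bot_iff (X : CochainComplex (ModuleCat.{u} R) ℤ) :
    infPur X ≠ ⊥ ↔ ∃ n : ℤ, ∀ i < n, PureExactAt X i := by
  constructor
  · intro h
    by_contra! H
    apply h
    generalize hv : infPur X = v
    have key : ∀ n : ℤ, v < ((n : WithTop ℤ) : WithBot (WithTop ℤ)) := by
      intro n
      obtain ⟨i, hi, hi'⟩ := H n
      rw [← hv]
      refine lt_of_le_of_lt (sInf_le ⟨i, hi', rfl⟩) ?_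
      exact_mod_cast hi
    induction v with
    | bot => rfl
    | coe v =>
      induction v with
      | top => exact absurd (key 0) (by simp)
      | coe m => exact absurd (key m) (lt_irrefl _)
  · rintro ⟨n, hn⟩ h
    have : ((n : WithTop ℤ) : WithBot (WithTop ℤ)) ≤ infPur X := by
      refine le_sInf ?_
      rintro _ ⟨i, hi, rfl⟩
      have : n ≤ i := by
        by_contra! hlt
        exact hi (hn i hlt)
      exact_mod_cast this
    rw [h] at this
    simp at this

lemma supPur_ne_top_iff (X : CochainComplex (ModuleCat.{u} R) ℤ) :
    supPur X ≠ ⊤ ↔ ∃ n : ℤ, ∀ i > n, PureExactAt X i := by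
  constructor
  · intro h
    by_contra! H
    apply h
    generalize hv : supPur X = v
    have key : ∀ n : ℤ, ((n : WithTop ℤ) : WithBot (WithTop ℤ)) < v := by
      intro n
      obtain ⟨i, hi, hi'⟩ := H n
      rw [← hv]
      refine lt_of_lt_of_le ?_ (le_sSup ⟨i, hi', rfl⟩)
      exact_mod_cast hi
    induction v with
    | bot => exact absurd (key 0) (by simp)
    | coe v =>
      induction v with
      | top => rfl
      | coe m => exact absurd (key m) (lt_irrefl _)
  · rintro ⟨n, hn⟩ h
    have : supPur X ≤ ((n : WithTop ℤ) : WithBot (WithTop ℤ)) := by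
      refine sSup_le ?_
      rintro _ ⟨i, hi, rfl⟩
      have : i ≤ n := by
        by_contra! hlt
        exact hi (hn i hlt)
      exact_mod_cast this
    rw [h] at this
    have h2 : ((n : WithTop ℤ) : WithBot (WithTop ℤ)) < ⊤ := by
      exact WithBot.coe_lt_coe.2 (WithTop.coe_lt_top n)
    exact absurd this (not_le.2 h2)

/-- `M ⊗_R X` is exact in degree `n` for every right `R`-module `M`. -/
def TensorExactAt (X : CochainComplex (ModuleCat.{u} R) ℤ) (n : ℤ) : Prop :=
  ∀ M : ModuleCat.{u} Rᵐᵒᵖ, (((tensorFunctor M).mapHomologicalComplex _).obj X).ExactAt n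

lemma tensorExactAt_iff (X : CochainComplex (ModuleCat.{u} R) ℤ) (i j k : ℤ) (hi : i + 1 = j)
    (hk : j + 1 = k) : TensorExactAt X j ↔ ∀ (M : ModuleCat.{u} Rᵐᵒᵖ)
      (y : (tensorFunctor M).obj (X.X j)), (tensorFunctor M).map (X.d j k) y = 0 →
        ∃ x, (tensorFunctor M).map (X.d i j) x = y := by
  refine forall_congr' fun M ↦ ?_
  rw [HomologicalComplex.exactAt_iff' _ i j k (by simp; lia) (by simp; lia),
    ShortComplex.ab_exact_iff]
  rfl

lemma PureExactAt.tensorExactAt {X : CochainComplex (ModuleCat.{u} R) ℤ} {n : ℤ}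
    (h : PureExactAt X n) : TensorExactAt X n := by
  rw [tensorExactAt_iff X (n - 1) n (n + 1) (by lia) rfl]
  intro M y hy
  obtain ⟨⟨D', p', i', ⟨A', f', w₁, hp'⟩, ⟨C', g', w₂, hi'⟩, fac'⟩,
    ⟨D, p, i, ⟨A, f, w₃, hp⟩, ⟨C, g, w₄, hi⟩, fac⟩, w, hw⟩ := h
  have hTi : Function.Injective ((tensorFunctor M).map i) :=
    (AddCommGrpCat.mono_iff_injective _).1 (hi.tensor M).mono_f
  have h1 : (tensorFunctor M).map p y = 0 := by
    apply hTi
    rw [← ConcreteCategory.comp_apply, ← Functor.map_comp, fac, hy, map_zero]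
  obtain ⟨a, rfl⟩ : ∃ a : (tensorFunctor M).obj A, (tensorFunctor M).map f a = y :=
    (ShortComplex.ab_exact_iff _).1 (hp.tensor M).exact y h1
  have := hi'.shortExact.mono_f
  have h2 : f ≫ cokernel.π (X.d (n - 1) n) = 0 := by
    rw [← kernel.lift_ι (X.d n (n + 1)) f (by rw [← fac, reassoc_of% w₃, zero_comp]),
      Category.assoc, w, comp_zero]
  have h3 : f ≫ g' = 0 := by
    rw [← cokernel.π_desc (X.d (n - 1) n) g' (by rw [← fac', Category.assoc, w₂, comp_zero]),
      reassoc_of% h2, zero_comp]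
  obtain ⟨l, h4⟩ : ∃ l : A ⟶ D', l ≫ i' = f :=
    ⟨hi'.shortExact.exact.lift f h3, hi'.shortExact.exact.lift_f f h3⟩
  have hTp : Function.Surjective ((tensorFunctor M).map p') :=
    (AddCommGrpCat.epi_iff_surjective _).1 (hp'.tensor M).epi_g
  obtain ⟨x, hx⟩ := hTp ((tensorFunctor M).map l a)
  refine ⟨x, ?_⟩
  rw [← fac', Functor.map_comp, ConcreteCategory.comp_apply, hx, ← ConcreteCategory.comp_apply,
    ← Functor.map_comp, h4]

/-- The multiplication map `R ⊗_R A → A`. -/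
def BalancedTensor.mul (A : ModuleCat.{u} R) :
    BalancedTensor R (ModuleCat.of Rᵐᵒᵖ R) A →+ A :=
  QuotientAddGroup.lift _
    (TensorProduct.liftAddHom (R := ℤ) (M := R) (N := A)
      (AddMonoidHom.mk' (fun r ↦ AddMonoidHom.mk' (fun a : A ↦ r • a) (smul_add r))
        (fun r s ↦ by ext a; exact add_smul r s a)) (fun n r a ↦ by
          change (n • r) • a = r • (n • a)
          rw [smul_assoc, smul_comm])) (by
    rw [balancedRelations, AddSubgroup.closure_le]
    rintro _ ⟨m, r, a, rfl⟩
    change (TensorProduct.liftAddHom _ _) _ = 0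
    rw [map_sub, sub_eq_zero]
    exact mul_smul (m : R) r a)

lemma BalancedTensor.mul_map {A B : ModuleCat.{u} R} (f : A ⟶ B)
    (x : (tensorFunctor (ModuleCat.of Rᵐᵒᵖ R)).obj A) :
    BalancedTensor.mul B ((tensorFunctor _).map f x) = f (BalancedTensor.mul A x) := by
  have : (BalancedTensor.mul B).comp (BalancedTensor.map _ f) =
      f.hom.toAddMonoidHom.comp (BalancedTensor.mul A) :=
    BalancedTensor.addHom_ext fun m a ↦ (f.hom.map_smul (m : R) a).symm
  exact DFunLike.congr_fun this x

lemma TensorExactAt.exact {X : CochainComplex (ModuleCat.{u} R) ℤ} {j : ℤ}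
    (h : TensorExactAt X j) (i k : ℤ) (hi : i + 1 = j) (hk : j + 1 = k) (y : X.X j)
    (hy : X.d j k y = 0) : ∃ x, X.d i j x = y := by
  rw [tensorExactAt_iff X i j k hi hk] at h
  obtain ⟨x, hx⟩ := h (ModuleCat.of Rᵐᵒᵖ R) (QuotientAddGroup.mk ((1 : R) ⊗ₜ y)) (by
    change QuotientAddGroup.mk ((1 : R) ⊗ₜ (X.d j k y)) = 0
    rw [hy, TensorProduct.tmul_zero, QuotientAddGroup.mk_zero])
  refine ⟨BalancedTensor.mul _ x, ?_⟩
  rw [← BalancedTensor.mul_map, hx]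
  exact one_smul R y

lemma TensorExactAt.kernel_lift_surjective {X : CochainComplex (ModuleCat.{u} R) ℤ} {j : ℤ}
    (h : TensorExactAt X j) (i k : ℤ) (hi : i + 1 = j) (hk : j + 1 = k) :
    Function.Surjective (kernel.lift (X.d j k) (X.d i j) (X.d_comp_d _ _ _)) := by
  intro z
  obtain ⟨x, hx⟩ := h.exact i k hi hk (kernel.ι (X.d j k) z) (by
    rw [← ConcreteCategory.comp_apply, kernel.condition]; rfl)
  refine ⟨x, (ModuleCat.mono_iff_injective (kernel.ι (X.d j k))).1 inferInstance ?_⟩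
  rw [← ConcreteCategory.comp_apply, kernel.lift_ι, hx]

lemma isPureExact_of_injective {S : ShortComplex (ModuleCat.{u} R)} (hS : S.ShortExact)
    (h : ∀ M : ModuleCat.{u} Rᵐᵒᵖ, Function.Injective ((tensorFunctor M).map S.f)) :
    IsPureExact S where
  shortExact := hS
  tensor M :=
    { exact := (ShortComplex.ab_exact_iff _).2 fun y hy ↦
        tensorFunctor_map_exact M S hS.exact hS.moduleCat_surjective_g y hy
      mono_f := (AddCommGrpCat.mono_iff_injective _).2 (h M)
      epi_g := (AddCommGrpCat.epi_iff_surjective _).2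
        (tensorFunctor_map_surjective M _ hS.moduleCat_surjective_g) }

lemma tensor_kernel_injective {X : CochainComplex (ModuleCat.{u} R) ℤ} {i j k : ℤ}
    (hi : i + 1 = j) (hk : j + 1 = k) (h : TensorExactAt X i) (h' : TensorExactAt X j)
    (M : ModuleCat.{u} Rᵐᵒᵖ) :
    Function.Injective ((tensorFunctor M).map (kernel.ι (X.d j k))) := by
  rw [injective_iff_map_eq_zero]
  intro z hz
  obtain ⟨w, rfl⟩ := tensorFunctor_map_surjective M _ (h'.kernel_lift_surjective i k hi hk) z
  rw [← ConcreteCategory.comp_apply, ← Functor.map_comp, kernel.lift_ι] at hz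
  obtain ⟨v, rfl⟩ := (tensorExactAt_iff X (i - 1) i j (by lia) hi).1 h M w hz
  rw [← ConcreteCategory.comp_apply, ← Functor.map_comp]
  have : X.d (i - 1) i ≫ kernel.lift (X.d j k) (X.d i j) (X.d_comp_d _ _ _) = 0 := by
    rw [← cancel_mono (kernel.ι _), Category.assoc, kernel.lift_ι, X.d_comp_d, zero_comp]
  rw [this, Functor.map_zero]
  rfl

lemma isPureMono_kernel {X : CochainComplex (ModuleCat.{u} R) ℤ} {i j k : ℤ}
    (hi : i + 1 = j) (hk : j + 1 = k) (h : TensorExactAt X i) (h' : TensorExactAt X j) :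
    IsPureMono (kernel.ι (X.d j k)) :=
  ⟨_, cokernel.π _, cokernel.condition _, isPureExact_of_injective
    { exact := ShortComplex.exact_cokernel _ } (tensor_kernel_injective hi hk h h')⟩

lemma isPureEpi_lift {X : CochainComplex (ModuleCat.{u} R) ℤ} {i j k l : ℤ}
    (hi : i + 1 = j) (hk : j + 1 = k) (hl : k + 1 = l) (h : TensorExactAt X i)
    (h' : TensorExactAt X j) (h'' : TensorExactAt X k) :
    IsPureEpi (kernel.lift (X.d k l) (X.d j k) (X.d_comp_d _ _ _)) := by
  refine ⟨_, kernel.ι (X.d j k), ?_, isPureExact_of_injective ?_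
    (tensor_kernel_injective hi hk h h')⟩
  · rw [← cancel_mono (kernel.ι _), Category.assoc, kernel.lift_ι, kernel.condition, zero_comp]
  · have : Epi (kernel.lift (X.d k l) (X.d j k) (X.d_comp_d _ _ _)) :=
      (ModuleCat.epi_iff_surjective _).2 (h''.kernel_lift_surjective j l hk hl)
    refine { exact := ShortComplex.exact_of_f_is_kernel _ ?_ }
    refine KernelFork.IsLimit.ofι' _ _ fun {A} a ha ↦ ⟨kernel.lift _ a ?_, kernel.lift_ι _ _ _⟩
    dsimp at ha
    rw [← kernel.lift_ι (X.d k l) (X.d j k) (X.d_comp_d _ _ _), reassoc_of% ha, zero_comp]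

lemma pureExactAt_of_tensorExactAt {X : CochainComplex (ModuleCat.{u} R) ℤ} {n : ℤ}
    (h : ∀ i, n - 2 ≤ i → i ≤ n + 1 → TensorExactAt X i) : PureExactAt X n := by
  have h₁ := h (n - 2) le_rfl (by lia)
  have h₂ := h (n - 1) (by lia) (by lia)
  have h₃ := h n (by lia) (by lia)
  have h₄ := h (n + 1) (by lia) le_rfl
  refine ⟨⟨_, kernel.lift (X.d n (n + 1)) (X.d (n - 1) n) (X.d_comp_d _ _ _), kernel.ι _,
    isPureEpi_lift (by lia) (by lia) rfl h₁ h₂ h₃, isPureMono_kernel (by lia) rfl h₂ h₃,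
      kernel.lift_ι _ _ _⟩,
    ⟨_, kernel.lift (X.d (n + 1) (n + 1 + 1)) (X.d n (n + 1)) (X.d_comp_d _ _ _), kernel.ι _,
    isPureEpi_lift (by lia) rfl rfl h₂ h₃ h₄, isPureMono_kernel rfl rfl h₃ h₄,
      kernel.lift_ι _ _ _⟩, ?_⟩
  have hs : Epi (kernel.lift (X.d n (n + 1)) (X.d (n - 1) n) (X.d_comp_d _ _ _)) :=
    (ModuleCat.epi_iff_surjective _).2 (h₃.kernel_lift_surjective _ _ (by lia) rfl)
  have w : kernel.ι (X.d n (n + 1)) ≫ cokernel.π (X.d (n - 1) n) = 0 := by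
    rw [← cancel_epi (kernel.lift (X.d n (n + 1)) (X.d (n - 1) n) (X.d_comp_d _ _ _)),
      kernel.lift_ι_assoc, cokernel.condition, comp_zero]
  refine ⟨w, isPureExact_of_injective ?_ (tensor_kernel_injective (by lia) rfl h₂ h₃)⟩
  refine { exact := ShortComplex.exact_of_g_is_cokernel _ ?_ }
  refine CokernelCofork.IsColimit.ofπ' _ _ fun {A} a ha ↦
    ⟨cokernel.desc _ a ?_, cokernel.π_desc _ _ _⟩
  dsimp at ha
  rw [← kernel.lift_ι (X.d n (n + 1)) (X.d (n - 1) n) (X.d_comp_d _ _ _), Category.assoc, ha,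
    comp_zero]

lemma forall_pureExactAt_iff (X : CochainComplex (ModuleCat.{u} R) ℤ) :
    (∀ n, PureExactAt X n) ↔ ∀ n, TensorExactAt X n :=
  ⟨fun h n ↦ (h n).tensorExactAt, fun h _ ↦ pureExactAt_of_tensorExactAt fun i _ _ ↦ h i⟩

lemma infPur_ne_bot_iff_tensor (X : CochainComplex (ModuleCat.{u} R) ℤ) :
    infPur X ≠ ⊥ ↔ ∃ n : ℤ, ∀ i < n, TensorExactAt X i := by
  rw [infPur_ne_bot_iff]
  exact ⟨fun ⟨n, h⟩ ↦ ⟨n, fun i hi ↦ (h i hi).tensorExactAt⟩, fun ⟨n, h⟩ ↦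
    ⟨n - 1, fun i hi ↦ pureExactAt_of_tensorExactAt fun j _ _ ↦ h j (by lia)⟩⟩

lemma supPur_ne_top_iff_tensor (X : CochainComplex (ModuleCat.{u} R) ℤ) :
    supPur X ≠ ⊤ ↔ ∃ n : ℤ, ∀ i > n, TensorExactAt X i := by
  rw [supPur_ne_top_iff]
  exact ⟨fun ⟨n, h⟩ ↦ ⟨n, fun i hi ↦ (h i hi).tensorExactAt⟩, fun ⟨n, h⟩ ↦
    ⟨n + 2, fun i hi ↦ pureExactAt_of_tensorExactAt fun j _ _ ↦ h j (by lia)⟩⟩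

/-- A module is pure projective if it is projective with respect to pure exact sequences. -/
def IsPureProjective (P : ModuleCat.{u} R) : Prop :=
  ∀ S : ShortComplex (ModuleCat.{u} R), IsPureExact S → ∀ f : P ⟶ S.X₃, ∃ g : P ⟶ S.X₂, g ≫ S.g = f

/-- A module is pure injective if it is injective with respect to pure exact sequences. -/
def IsPureInjective (I : ModuleCat.{u} R) : Prop :=
  ∀ S : ShortComplex (ModuleCat.{u} R), IsPureExact S → ∀ f : S.X₁ ⟶ I, ∃ g : S.X₂ ⟶ I, S.f ≫ g = f

lemma IsPureProjective.of_iso {P Q : ModuleCat.{u} R} (hP : IsPureProjective P) (e : P ≅ Q) :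
    IsPureProjective Q := fun S hS f ↦ by
  obtain ⟨g, hg⟩ := hP S hS (e.hom ≫ f)
  exact ⟨e.inv ≫ g, by rw [Category.assoc, hg, e.inv_hom_id_assoc]⟩

lemma IsPureInjective.of_iso {P Q : ModuleCat.{u} R} (hP : IsPureInjective P) (e : P ≅ Q) :
    IsPureInjective Q := fun S hS f ↦ by
  obtain ⟨g, hg⟩ := hP S hS (f ≫ e.inv)
  exact ⟨g ≫ e.hom, by rw [reassoc_of% hg, e.inv_hom_id, Category.comp_id]⟩

lemma isPureProjective_of_isZero {P : ModuleCat.{u} R} (hP : IsZero P) : IsPureProjective P :=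
  fun _ _ _ ↦ ⟨0, hP.eq_of_src _ _⟩

lemma isPureInjective_of_isZero {P : ModuleCat.{u} R} (hP : IsZero P) : IsPureInjective P :=
  fun _ _ _ ↦ ⟨0, hP.eq_of_tgt _ _⟩

lemma IsPureProjective.biprod {P Q : ModuleCat.{u} R} (hP : IsPureProjective P)
    (hQ : IsPureProjective Q) : IsPureProjective (P ⊞ Q) := fun S hS f ↦ by
  obtain ⟨g, hg⟩ := hP S hS (biprod.inl ≫ f)
  obtain ⟨h, hh⟩ := hQ S hS (biprod.inr ≫ f)
  exact ⟨biprod.desc g h, by apply biprod.hom_ext' <;> simp [hg, hh]⟩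

lemma IsPureInjective.biprod {P Q : ModuleCat.{u} R} (hP : IsPureInjective P)
    (hQ : IsPureInjective Q) : IsPureInjective (P ⊞ Q) := fun S hS f ↦ by
  obtain ⟨g, hg⟩ := hP S hS (f ≫ biprod.fst)
  obtain ⟨h, hh⟩ := hQ S hS (f ≫ biprod.snd)
  exact ⟨biprod.lift g h, by apply biprod.hom_ext <;> simp [hg, hh]⟩

/-- A property of complexes which holds for a zero complex and is stable under shifts and
mapping cones defines a triangulated subcategory of the homotopy category. -/
lemma isTriangulated_of_mappingCone (P : ObjectProperty (CochainComplex (ModuleCat.{u} R) ℤ))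
    (h0 : ∀ K, IsZero K → P K) (hshift : ∀ (K) (n : ℤ), P K → P (K⟦n⟧))
    (hcone : ∀ {K L} (f : K ⟶ L), P K → P L → P (CochainComplex.mappingCone f))
    (Q : ObjectProperty (HomotopyCategory (ModuleCat.{u} R) (ComplexShape.up ℤ)))
    (hQ : ∀ X, Q X ↔ P X.as) : Q.IsTriangulated := by
  have : Q.ContainsZero :=
    ⟨(HomotopyCategory.quotient _ _).obj 0, Functor.map_isZero _ (isZero_zero _),
      (hQ _).2 (h0 _ (isZero_zero _))⟩
  have : Q.IsStableUnderShift ℤ :=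
    ⟨fun n ↦ ⟨fun X hX ↦ by
      obtain ⟨K : CochainComplex _ _, rfl⟩ := X.quotient_obj_surjective
      rw [ObjectProperty.prop_shift_iff, HomotopyCategory.shift_quotient_obj]
      exact (hQ _).2 (hshift K n ((hQ _).1 hX))⟩⟩
  have : Q.IsTriangulatedClosed₃ := ⟨fun T hT h₁ h₂ ↦ by
    obtain ⟨f : T.obj₁.as ⟶ T.obj₂.as, hf⟩ :=
      (HomotopyCategory.quotient _ _).map_surjective T.mor₁
    refine ⟨_, (hQ _).2 (hcone f ((hQ _).1 h₁) ((hQ _).1 h₂)),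
      ⟨Triangle.π₃.mapIso (isoTriangleOfIso₁₂ T _ hT
        (HomotopyCategory.mappingCone_triangleh_distinguished f)
        (Iso.refl _) (Iso.refl _) ?_)⟩⟩
    exact (Category.comp_id _).trans (hf.symm.trans (Category.id_comp _).symm)⟩
  exact { toIsTriangulatedClosed₂ := .of_isTriangulatedClosed₃ }

variable (R)

/-- The homotopy category `K(R)` of complexes of left `R`-modules. -/
abbrev K := HomotopyCategory (ModuleCat.{u} R) (ComplexShape.up ℤ)

/-- The bounded complexes in `K(R)`. -/
def bounded : ObjectProperty (K R) := fun X ↦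
  ∃ m n : ℤ, CochainComplex.IsStrictlyGE X.as m ∧ CochainComplex.IsStrictlyLE X.as n

/-- The bounded above complexes of pure projective modules in `K(R)`. -/
def minusPP : ObjectProperty (K R) := fun X ↦
  (∃ n : ℤ, CochainComplex.IsStrictlyLE X.as n) ∧ ∀ i, IsPureProjective (X.as.X i)

/-- The bounded below complexes of pure injective modules in `K(R)`. -/
def plusPI : ObjectProperty (K R) := fun X ↦
  (∃ n : ℤ, CochainComplex.IsStrictlyGE X.as n) ∧ ∀ i, IsPureInjective (X.as.X i)

/-- The pure exact complexes in `K(R)`. -/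
def pureExact : ObjectProperty (K R) := fun X ↦ ∀ n, PureExactAt X.as n

/-- The complexes `X` in `K(R)` with `inf_p X > -∞`. -/
def infPurFinite : ObjectProperty (K R) := fun X ↦ infPur X.as ≠ ⊥

/-- The complexes `X` in `K(R)` with `sup_p X < ∞`. -/
def supPurFinite : ObjectProperty (K R) := fun X ↦ supPur X.as ≠ ⊤

variable {R}

lemma isStrictlyLE_mappingCone {X Y : CochainComplex (ModuleCat.{u} R) ℤ} (f : X ⟶ Y)
    {a b : ℤ} (ha : X.IsStrictlyLE a) (hb : Y.IsStrictlyLE b) :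
    (CochainComplex.mappingCone f).IsStrictlyLE (max a b) := by
  rw [CochainComplex.isStrictlyLE_iff]
  intro i hi
  rw [CochainComplex.mappingCone.isZero_X_iff]
  exact ⟨X.isZero_of_isStrictlyLE a _ (by lia), Y.isZero_of_isStrictlyLE b _ (by lia)⟩

lemma isStrictlyGE_mappingCone {X Y : CochainComplex (ModuleCat.{u} R) ℤ} (f : X ⟶ Y)
    {a b : ℤ} (ha : X.IsStrictlyGE a) (hb : Y.IsStrictlyGE b) :
    (CochainComplex.mappingCone f).IsStrictlyGE (min (a - 1) b) := by
  rw [CochainComplex.isStrictlyGE_iff]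
  intro i hi
  rw [CochainComplex.mappingCone.isZero_X_iff]
  exact ⟨X.isZero_of_isStrictlyGE a _ (by lia), Y.isZero_of_isStrictlyGE b _ (by lia)⟩

/-- The terms of a mapping cone. -/
def mappingConeXIso {X Y : CochainComplex (ModuleCat.{u} R) ℤ} (f : X ⟶ Y) (i : ℤ) :
    (CochainComplex.mappingCone f).X i ≅ X.X (i + 1) ⊞ Y.X i :=
  HomologicalComplex.homotopyCofiber.XIsoBiprod f i (i + 1) rfl

lemma isStrictly_of_isZero {X : CochainComplex (ModuleCat.{u} R) ℤ} (hX : IsZero X) (n : ℤ) :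
    X.IsStrictlyLE n ∧ X.IsStrictlyGE n := by
  rw [CochainComplex.isStrictlyGE_iff, CochainComplex.isStrictlyLE_iff]
  exact ⟨fun i _ ↦ (HomologicalComplex.eval _ _ i).map_isZero hX,
    fun i _ ↦ (HomologicalComplex.eval _ _ i).map_isZero hX⟩

instance : (bounded R).IsTriangulated :=
  isTriangulated_of_mappingCone (fun X ↦ ∃ m n : ℤ, X.IsStrictlyGE m ∧ X.IsStrictlyLE n)
    (fun _ hX ↦ ⟨0, 0, (isStrictly_of_isZero hX 0).2, (isStrictly_of_isZero hX 0).1⟩)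
    (fun X a ⟨m, n, _, _⟩ ↦ ⟨m - a, n - a, X.isStrictlyGE_shift m a _ (by lia),
      X.isStrictlyLE_shift n a _ (by lia)⟩)
    (fun f ⟨_, _, h₁, h₂⟩ ⟨_, _, h₃, h₄⟩ ↦
      ⟨_, _, isStrictlyGE_mappingCone f h₁ h₃, isStrictlyLE_mappingCone f h₂ h₄⟩)
    _ (fun _ ↦ Iff.rfl)

instance : (minusPP R).IsTriangulated :=
  isTriangulated_of_mappingCone
    (fun X ↦ (∃ n : ℤ, X.IsStrictlyLE n) ∧ ∀ i, IsPureProjective (X.X i))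
    (fun _ hX ↦ ⟨⟨0, (isStrictly_of_isZero hX 0).1⟩, fun i ↦
      isPureProjective_of_isZero ((HomologicalComplex.eval _ _ i).map_isZero hX)⟩)
    (fun X a ⟨⟨n, _⟩, h⟩ ↦ ⟨⟨n - a, X.isStrictlyLE_shift n a _ (by lia)⟩, fun i ↦
      (h (i + a)).of_iso (X.shiftFunctorObjXIso a i _ rfl).symm⟩)
    (fun f ⟨⟨_, h₁⟩, h₂⟩ ⟨⟨_, h₃⟩, h₄⟩ ↦ ⟨⟨_, isStrictlyLE_mappingCone f h₁ h₃⟩, fun i ↦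
      ((h₂ (i + 1)).biprod (h₄ i)).of_iso (mappingConeXIso f i).symm⟩)
    _ (fun _ ↦ Iff.rfl)

instance : (plusPI R).IsTriangulated :=
  isTriangulated_of_mappingCone
    (fun X ↦ (∃ n : ℤ, X.IsStrictlyGE n) ∧ ∀ i, IsPureInjective (X.X i))
    (fun _ hX ↦ ⟨⟨0, (isStrictly_of_isZero hX 0).2⟩, fun i ↦
      isPureInjective_of_isZero ((HomologicalComplex.eval _ _ i).map_isZero hX)⟩)
    (fun X a ⟨⟨n, _⟩, h⟩ ↦ ⟨⟨n - a, X.isStrictlyGE_shift n a _ (by lia)⟩, fun i ↦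
      (h (i + a)).of_iso (X.shiftFunctorObjXIso a i _ rfl).symm⟩)
    (fun f ⟨⟨_, h₁⟩, h₂⟩ ⟨⟨_, h₃⟩, h₄⟩ ↦ ⟨⟨_, isStrictlyGE_mappingCone f h₁ h₃⟩, fun i ↦
      ((h₂ (i + 1)).biprod (h₄ i)).of_iso (mappingConeXIso f i).symm⟩)
    _ (fun _ ↦ Iff.rfl)

/-- The functor `X ↦ H^n(M ⊗_R X)` on `K(R)`. -/
def tensorHomology (M : ModuleCat.{u} Rᵐᵒᵖ) (n : ℤ) : K R ⥤ AddCommGrpCat.{u} :=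
  (tensorFunctor M).mapHomotopyCategory (ComplexShape.up ℤ) ⋙
    HomotopyCategory.homologyFunctor AddCommGrpCat.{u} (ComplexShape.up ℤ) n

instance (M : ModuleCat.{u} Rᵐᵒᵖ) (n : ℤ) : (tensorHomology (R := R) M n).IsHomological := by
  unfold tensorHomology
  infer_instance

lemma tensorExactAt_iff_isZero (X : K R) (n : ℤ) :
    TensorExactAt X.as n ↔ ∀ M : ModuleCat.{u} Rᵐᵒᵖ, IsZero ((tensorHomology M n).obj X) := by
  refine forall_congr' fun M ↦ ?_
  rw [HomologicalComplex.exactAt_iff_isZero_homology]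
  exact (((HomotopyCategory.homologyFunctorFactors AddCommGrpCat.{u} (ComplexShape.up ℤ) n).app
    (((tensorFunctor M).mapHomologicalComplex _).obj X.as)).isZero_iff).symm

lemma tensorExactAt_of_iso {X Y : K R} (e : X ≅ Y) {n : ℤ} (h : TensorExactAt X.as n) :
    TensorExactAt Y.as n := by
  rw [tensorExactAt_iff_isZero] at h ⊢
  exact fun M ↦ (h M).of_iso ((tensorHomology M n).mapIso e.symm)

lemma tensorExactAt_of_triangle (T : Triangle (K R)) (hT : T ∈ distTriang (K R)) {n : ℤ}
    (h₁ : TensorExactAt T.obj₁.as n) (h₃ : TensorExactAt T.obj₃.as n) :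
    TensorExactAt T.obj₂.as n := by
  rw [tensorExactAt_iff_isZero] at h₁ h₃ ⊢
  exact fun M ↦ ((tensorHomology M n).map_distinguished_exact T hT).isZero_X₂
    ((h₁ M).eq_of_src _ _) ((h₃ M).eq_of_tgt _ _)

lemma tensorExactAt_shift_iff (X : K R) (a n : ℤ) :
    TensorExactAt (X⟦a⟧).as n ↔ TensorExactAt X.as (a + n) := by
  rw [tensorExactAt_iff_isZero, tensorExactAt_iff_isZero]
  refine forall_congr' fun M ↦ ?_
  exact (((HomotopyCategory.homologyFunctor AddCommGrpCat.{u} (ComplexShape.up ℤ) n).mapIso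
    ((((tensorFunctor M).mapHomotopyCategory (ComplexShape.up ℤ)).commShiftIso a).app X)) ≪≫
    ((HomotopyCategory.homologyFunctor AddCommGrpCat.{u} (ComplexShape.up ℤ) 0).shiftIso a n (a + n)
      rfl).app _).isZero_iff

lemma tensorExactAt_of_isZero {X : K R} (hX : IsZero X) (n : ℤ) : TensorExactAt X.as n := by
  rw [tensorExactAt_iff_isZero]
  exact fun M ↦ (tensorHomology M n).map_isZero hX

lemma pureExact_iff (X : K R) : pureExact R X ↔ ∀ n, TensorExactAt X.as n :=
  forall_pureExactAt_iff X.as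

lemma infPurFinite_iff (X : K R) : infPurFinite R X ↔ ∃ n : ℤ, ∀ i < n, TensorExactAt X.as i :=
  infPur_ne_bot_iff_tensor X.as

lemma supPurFinite_iff (X : K R) : supPurFinite R X ↔ ∃ n : ℤ, ∀ i > n, TensorExactAt X.as i :=
  supPur_ne_top_iff_tensor X.as

instance : (pureExact R).IsClosedUnderIsomorphisms where
  of_iso e h := by
    rw [pureExact_iff] at h ⊢
    exact fun n ↦ tensorExactAt_of_iso e (h n)

instance : (infPurFinite R).IsClosedUnderIsomorphisms where
  of_iso e h := by
    rw [infPurFinite_iff] at h ⊢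
    obtain ⟨n, h⟩ := h
    exact ⟨n, fun i hi ↦ tensorExactAt_of_iso e (h i hi)⟩

instance : (supPurFinite R).IsClosedUnderIsomorphisms where
  of_iso e h := by
    rw [supPurFinite_iff] at h ⊢
    obtain ⟨n, h⟩ := h
    exact ⟨n, fun i hi ↦ tensorExactAt_of_iso e (h i hi)⟩

instance : (pureExact R).IsTriangulated where
  exists_zero := ⟨_, isZero_zero _, (pureExact_iff _).2 (tensorExactAt_of_isZero (isZero_zero _))⟩
  isStableUnderShiftBy a := ⟨fun X hX ↦ by
    rw [pureExact_iff] at hX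
    rw [ObjectProperty.prop_shift_iff, pureExact_iff]
    exact fun n ↦ (tensorExactAt_shift_iff X a n).2 (hX _)⟩
  toIsTriangulatedClosed₂ := .mk' fun T hT h₁ h₃ ↦ by
    rw [pureExact_iff] at h₁ h₃ ⊢
    exact fun n ↦ tensorExactAt_of_triangle T hT (h₁ n) (h₃ n)

instance : (infPurFinite R).IsTriangulated where
  exists_zero := ⟨_, isZero_zero _, (infPurFinite_iff _).2
    ⟨0, fun i _ ↦ tensorExactAt_of_isZero (isZero_zero _) i⟩⟩
  isStableUnderShiftBy a := ⟨fun X hX ↦ by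
    obtain ⟨n, hn⟩ := (infPurFinite_iff _).1 hX
    rw [ObjectProperty.prop_shift_iff, infPurFinite_iff]
    exact ⟨n - a, fun i hi ↦ (tensorExactAt_shift_iff X a i).2 (hn _ (by lia))⟩⟩
  toIsTriangulatedClosed₂ := .mk' fun T hT h₁ h₃ ↦ by
    obtain ⟨m, hm⟩ := (infPurFinite_iff _).1 h₁
    obtain ⟨n, hn⟩ := (infPurFinite_iff _).1 h₃
    exact (infPurFinite_iff _).2 ⟨min m n, fun i hi ↦
      tensorExactAt_of_triangle T hT (hm i (by lia)) (hn i (by lia))⟩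

instance : (supPurFinite R).IsTriangulated where
  exists_zero := ⟨_, isZero_zero _, (supPurFinite_iff _).2
    ⟨0, fun i _ ↦ tensorExactAt_of_isZero (isZero_zero _) i⟩⟩
  isStableUnderShiftBy a := ⟨fun X hX ↦ by
    obtain ⟨n, hn⟩ := (supPurFinite_iff _).1 hX
    rw [ObjectProperty.prop_shift_iff, supPurFinite_iff]
    exact ⟨n - a, fun i hi ↦ (tensorExactAt_shift_iff X a i).2 (hn _ (by lia))⟩⟩
  toIsTriangulatedClosed₂ := .mk' fun T hT h₁ h₃ ↦ by
    obtain ⟨m, hm⟩ := (supPurFinite_iff _).1 h₁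
    obtain ⟨n, hn⟩ := (supPurFinite_iff _).1 h₃
    exact (supPurFinite_iff _).2 ⟨max m n, fun i hi ↦
      tensorExactAt_of_triangle T hT (hm i (by lia)) (hn i (by lia))⟩

variable (R)

/-- The bounded homotopy category `K^b(R)`, a triangulated subcategory of `K(R)`. -/
abbrev Kb := (bounded R).FullSubcategory

/-- The triangulated subcategory of `K^b(R)` of the pure exact complexes. -/
abbrev boundedPureExact : ObjectProperty (Kb R) := (pureExact R).inverseImage (bounded R).ι

/-- `K^{-,pb}(PP)`: the triangulated subcategory of `K(R)` of the bounded above complexes `X` of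
pure projective modules with `inf_p X > -∞`. -/
abbrev KMinusPbPP := (minusPP R ⊓ infPurFinite R).FullSubcategory

/-- `K^{+,pb}(PI)`: the triangulated subcategory of `K(R)` of the bounded below complexes `X` of
pure injective modules with `sup_p X < ∞`. -/
abbrev KPlusPbPI := (plusPI R ⊓ supPurFinite R).FullSubcategory

/-- The bounded pure derived category: the Verdier quotient of `K^b(R)` by the pure exact
complexes, i.e. the localization of `K^b(R)` at the morphisms with pure exact cone. -/
def DbPur := (boundedPureExact R).trW.Localization

instance : Category (DbPur R) := inferInstanceAs (Category (boundedPureExact R).trW.Localization)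

/-- The localization functor `K^b(R) → D^b_pur(R)`. -/
def DbPur.Q : Kb R ⥤ DbPur R := (boundedPureExact R).trW.Q

instance : (DbPur.Q R).IsLocalization (boundedPureExact R).trW :=
  inferInstanceAs ((boundedPureExact R).trW.Q.IsLocalization _)

instance : Preadditive (DbPur R) :=
  Localization.preadditive (DbPur.Q R) (boundedPureExact R).trW

instance : (DbPur.Q R).Additive :=
  Localization.functor_additive (DbPur.Q R) (boundedPureExact R).trW

instance : HasZeroObject (DbPur R) := (DbPur.Q R).hasZeroObject_of_additive

instance : HasShift (DbPur R) ℤ := HasShift.localized (DbPur.Q R) (boundedPureExact R).trW ℤ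

instance : (DbPur.Q R).CommShift ℤ :=
  Functor.CommShift.localized (DbPur.Q R) (boundedPureExact R).trW ℤ

instance (n : ℤ) : (shiftFunctor (DbPur R) n).Additive := by
  rw [Localization.functor_additive_iff (DbPur.Q R) (boundedPureExact R).trW]
  exact Functor.additive_of_iso ((DbPur.Q R).commShiftIso n)

instance : Pretriangulated (DbPur R) :=
  Triangulated.Localization.pretriangulated (DbPur.Q R) (boundedPureExact R).trW

instance : (DbPur.Q R).IsTriangulated :=
  Triangulated.Localization.isTriangulated_functor (DbPur.Q R) (boundedPureExact R).trW

instance : IsTriangulated (DbPur R) :=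
  Triangulated.Localization.isTriangulated (DbPur.Q R) (boundedPureExact R).trW

/-- Two triangulated categories are triangle equivalent: there is an equivalence of categories
which commutes with the shifts and preserves distinguished triangles. -/
def TriangleEquivalent (C D : Type*) [Category* C] [Category* D] [HasZeroObject C]
    [HasZeroObject D] [Preadditive C] [Preadditive D] [HasShift C ℤ] [HasShift D ℤ]
    [∀ n : ℤ, (shiftFunctor C n).Additive] [∀ n : ℤ, (shiftFunctor D n).Additive]
    [Pretriangulated C] [Pretriangulated D] : Prop :=
  ∃ (F : C ⥤ D) (_ : F.CommShift ℤ), F.IsEquivalence ∧ F.IsTriangulated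

end

end PureDerived

/-!
A complex is pure exact if and only if it stays acyclic under `M ⊗ -` for every right module `M`.
Bounded above complexes of pure projectives have no nonzero morphism in the homotopy category to a
pure exact complex, hence embed fully faithfully in the Verdier quotient `D` of `K(R)` by the pure
exact complexes. So do the bounded complexes modulo the bounded pure exact ones, because a roof
between bounded complexes can be made bounded: its apex may be replaced by a resolution, and a
morphism from the resolution to a bounded complex factors through a truncation. The two essential
images in `D` agree: a bounded complex has a pure projective resolution, by dévissage from a single
module, and a resolution which is pure exact in low degrees is isomorphic in `D` to one of its
truncations. The case of pure injectives is dual; enough pure projectives come from finitely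
presented modules, and enough pure injectives from character modules.
-/

namespace PureDerived

noncomputable section

section BalancedTensor

variable {R : Type u} [Ring R]

/-- The homomorphism out of `M ⊗_R A` induced by a balanced biadditive map. -/
def BalancedTensor.lift {M : ModuleCat.{u} Rᵐᵒᵖ} {A : ModuleCat.{u} R} {G : Type*}
    [AddCommGroup G] (h : M →+ A →+ G)
    (hh : ∀ (r : R) (m : M) (a : A), h (MulOpposite.op r • m) a = h m (r • a)) :
    BalancedTensor R M A →+ G :=
  QuotientAddGroup.lift _ (TensorProduct.liftAddHom (R := ℤ) h (by simp)) (by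
    rw [balancedRelations, AddSubgroup.closure_le]
    rintro _ ⟨m, r, a, rfl⟩
    change (TensorProduct.liftAddHom _ _) _ = 0
    rw [map_sub, TensorProduct.liftAddHom_tmul, TensorProduct.liftAddHom_tmul, hh, sub_self])

/-- The canonical biadditive map `M → A → M ⊗_R A`. -/
def BalancedTensor.mk (M : ModuleCat.{u} Rᵐᵒᵖ) (A : ModuleCat.{u} R) :
    M →+ A →+ BalancedTensor R M A :=
  AddMonoidHom.mk' (fun m ↦ AddMonoidHom.mk' (fun a ↦ QuotientAddGroup.mk (m ⊗ₜ[ℤ] a))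
    (fun a b ↦ by rw [TensorProduct.tmul_add, QuotientAddGroup.mk_add]))
    (fun m n ↦ by
      ext a
      change QuotientAddGroup.mk ((m + n) ⊗ₜ[ℤ] a) = _
      rw [TensorProduct.add_tmul, QuotientAddGroup.mk_add]
      rfl)

lemma BalancedTensor.mk_smul {M : ModuleCat.{u} Rᵐᵒᵖ} {A : ModuleCat.{u} R} (r : R) (m : M)
    (a : A) : BalancedTensor.mk M A (MulOpposite.op r • m) a = BalancedTensor.mk M A m (r • a) :=
  QuotientAddGroup.eq_iff_sub_mem.2 (AddSubgroup.subset_closure ⟨m, r, a, rfl⟩)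

lemma BalancedTensor.induction {M : ModuleCat.{u} Rᵐᵒᵖ} {A : ModuleCat.{u} R}
    {P : BalancedTensor R M A → Prop} (h0 : P 0) (hmk : ∀ m a, P (BalancedTensor.mk M A m a))
    (hadd : ∀ x y, P x → P y → P (x + y)) (x : BalancedTensor R M A) : P x := by
  obtain ⟨x, rfl⟩ := QuotientAddGroup.mk_surjective x
  induction x using TensorProduct.induction_on with
  | zero => exact h0
  | tmul m a => exact hmk m a
  | add x y hx hy => exact hadd _ _ hx hy

lemma BalancedTensor.hom_ext {M : ModuleCat.{u} Rᵐᵒᵖ} {A : ModuleCat.{u} R} {G : Type*}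
    [AddCommGroup G] {f g : BalancedTensor R M A →+ G}
    (h : ∀ m a, f (BalancedTensor.mk M A m a) = g (BalancedTensor.mk M A m a)) : f = g := by
  refine DFunLike.ext _ _ fun x ↦ BalancedTensor.induction (P := fun x ↦ f x = g x)
    ((map_zero f).trans (map_zero g).symm) h (fun x y hx hy ↦ ?_) x
  rw [map_add, map_add, hx, hy]

end BalancedTensor

section CharacterDual

variable {R : Type u} [Ring R]

/-- The left `R`-module of characters of a right `R`-module. -/
def RightDual (N : ModuleCat.{u} Rᵐᵒᵖ) : Type u := N →+ AddCircle (1 : ℚ)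
deriving AddCommGroup, FunLike

/-- The right `R`-module of characters of a left `R`-module. -/
def LeftDual (A : ModuleCat.{u} R) : Type u := A →+ AddCircle (1 : ℚ)
deriving AddCommGroup, FunLike, AddMonoidHomClass

open scoped DomMulAct in
instance (A : ModuleCat.{u} R) : Module Rᵐᵒᵖ (LeftDual A) :=
  inferInstanceAs (Module Rᵈᵐᵃ (A →+ AddCircle (1 : ℚ)))

open scoped DomMulAct in
instance (N : ModuleCat.{u} Rᵐᵒᵖ) : Module R (RightDual N) :=
  letI : Module Rᵐᵒᵖᵐᵒᵖ (RightDual N) := inferInstanceAs (Module Rᵐᵒᵖᵈᵐᵃ (N →+ AddCircle (1 : ℚ)))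
  Module.compHom _ (RingEquiv.opOp R).toRingHom

@[ext]
lemma RightDual.ext {N : ModuleCat.{u} Rᵐᵒᵖ} {φ ψ : RightDual N} (h : ∀ n, φ n = ψ n) : φ = ψ :=
  DFunLike.ext _ _ h

lemma LeftDual.ext {A : ModuleCat.{u} R} {φ ψ : LeftDual A} (h : ∀ a, φ a = ψ a) : φ = ψ :=
  DFunLike.ext _ _ h

variable {N : ModuleCat.{u} Rᵐᵒᵖ} {A : ModuleCat.{u} R}

/-- The map `(N ⊗ A)⁺ → Hom(A, N⁺)` of the tensor-hom adjunction. -/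
def curry (χ : BalancedTensor R N A →+ AddCircle (1 : ℚ)) : A →ₗ[R] RightDual N where
  toFun a := χ.comp ((BalancedTensor.mk N A).flip a)
  map_add' a b := RightDual.ext fun n ↦
    (congrArg χ (map_add (BalancedTensor.mk N A n) a b)).trans (map_add χ _ _)
  map_smul' r a := RightDual.ext fun n ↦ (congrArg χ (BalancedTensor.mk_smul r n a)).symm

/-- The map `(N ⊗ A)⁺ → Hom(N, A⁺)` of the tensor-hom adjunction for right modules. -/
def curryLeft (χ : BalancedTensor R N A →+ AddCircle (1 : ℚ)) : N →ₗ[Rᵐᵒᵖ] LeftDual A where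
  toFun n := χ.comp (BalancedTensor.mk N A n)
  map_add' m n := LeftDual.ext fun a ↦
    (congrArg χ (DFunLike.congr_fun (map_add (BalancedTensor.mk N A) m n) a)).trans (map_add χ _ _)
  map_smul' r n := LeftDual.ext fun a ↦ congrArg χ (BalancedTensor.mk_smul r.unop n a)

/-- The map `Hom(A, N⁺) → (N ⊗ A)⁺` of the tensor-hom adjunction. -/
def uncurry (g : A →ₗ[R] RightDual N) : BalancedTensor R N A →+ AddCircle (1 : ℚ) :=
  BalancedTensor.lift (AddMonoidHom.flip (g.toAddMonoidHom : A →+ (N →+ AddCircle (1 : ℚ))))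
    fun r n a ↦ (DFunLike.congr_fun (g.map_smul r a) n).symm

lemma isPureInjective_rightDual (N : ModuleCat.{u} Rᵐᵒᵖ) :
    IsPureInjective (ModuleCat.of R (RightDual N)) := fun S hS f ↦ by
  have injective : Function.Injective (BalancedTensor.map N S.f) :=
    (AddCommGrpCat.mono_iff_injective _).1 (hS.tensor N).mono_f
  obtain ⟨χ, hχ⟩ := CharacterModule.dual_surjective_of_injective
    (BalancedTensor.map N S.f).toIntLinearMap injective (uncurry f.hom)
  refine ⟨ModuleCat.ofHom (curry χ), ?_⟩
  ext a (n : N)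
  exact DFunLike.congr_fun hχ (BalancedTensor.mk N S.X₁ n a)

/-- The evaluation map from a module to its double character module. -/
def toDoubleDual (A : ModuleCat.{u} R) :
    A →ₗ[R] RightDual (ModuleCat.of Rᵐᵒᵖ (LeftDual A)) where
  toFun a := (AddMonoidHom.eval a : (A →+ AddCircle (1 : ℚ)) →+ AddCircle (1 : ℚ))
  map_add' a b := RightDual.ext (N := .of _ (LeftDual A)) fun φ : LeftDual A ↦ map_add φ a b
  map_smul' _ _ := rfl

/-- The dual of a linear map of right modules. -/
def RightDual.precomp {N' : ModuleCat.{u} Rᵐᵒᵖ} (e : N →ₗ[Rᵐᵒᵖ] N') :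
    RightDual N' →ₗ[R] RightDual N where
  toFun ξ := AddMonoidHom.comp (show N' →+ AddCircle (1 : ℚ) from ξ) e.toAddMonoidHom
  map_add' _ _ := rfl
  map_smul' r ξ := RightDual.ext fun n ↦ congrArg ξ (e.map_smul (MulOpposite.op r) n).symm

lemma tensorFunctor_map_toDoubleDual_injective (N : ModuleCat.{u} Rᵐᵒᵖ) (A : ModuleCat.{u} R) :
    Function.Injective ((tensorFunctor N).map (ModuleCat.ofHom (toDoubleDual A))) := by
  let A' := ModuleCat.of Rᵐᵒᵖ (LeftDual A)
  let ι : BalancedTensor R N A →+ BalancedTensor R N (.of R (RightDual A')) :=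
    BalancedTensor.map N (ModuleCat.ofHom (toDoubleDual A))
  have extends_character (χ : BalancedTensor R N A →+ AddCircle (1 : ℚ)) :
      (uncurry (A := .of R (RightDual A')) (RightDual.precomp (N' := A') (curryLeft χ))).comp ι =
        χ :=
    BalancedTensor.hom_ext fun _ _ ↦ rfl
  refine (injective_iff_map_eq_zero ι).2 fun t ht ↦
    CharacterModule.eq_zero_of_character_apply fun χ ↦ ?_
  exact (DFunLike.congr_fun (extends_character χ) t).symm.trans
    ((congrArg _ ht).trans (map_zero _))

lemma exists_isPureMono (A : ModuleCat.{u} R) :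
    ∃ (I : ModuleCat.{u} R) (ι : A ⟶ I), IsPureInjective I ∧ IsPureMono ι := by
  let ι := ModuleCat.ofHom (toDoubleDual A)
  have : Mono ι := (ModuleCat.mono_iff_injective ι).2 <|
    (injective_iff_map_eq_zero (toDoubleDual A)).2 fun a ha ↦
      CharacterModule.eq_zero_of_character_apply fun c ↦ DFunLike.congr_fun ha (c : LeftDual A)
  exact ⟨_, ι, isPureInjective_rightDual _, cokernel ι, cokernel.π ι, cokernel.condition ι,
    isPureExact_of_injective { exact := ShortComplex.exact_cokernel ι }
      fun N ↦ tensorFunctor_map_toDoubleDual_injective N A⟩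

end CharacterDual

section EquationalPurity

variable {R : Type u} [Ring R]

lemma BalancedTensor.sum_mk_sum_smul {N : ModuleCat.{u} Rᵐᵒᵖ} {B : ModuleCat.{u} R} {ι κ : Type*}
    (s : Finset ι) (t : Finset κ) (r : ι → κ → R) (x : ι → N) (b : κ → B) :
    ∑ i ∈ s, BalancedTensor.mk N B (x i) (∑ j ∈ t, r i j • b j) =
      ∑ j ∈ t, BalancedTensor.mk N B (∑ i ∈ s, MulOpposite.op (r i j) • x i) (b j) := by
  simp only [map_sum, AddMonoidHom.finsetSum_apply, BalancedTensor.mk_smul]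
  exact Finset.sum_comm

/-- A homomorphism `f : A ⟶ B` is equationally pure if every finite system of `R`-linear equations
with constants in `A` that is solvable in `B` is solvable in `A`. -/
def IsEquationallyPure {A B : ModuleCat.{u} R} (f : A ⟶ B) : Prop :=
  ∀ (m n : ℕ) (r : Fin m → Fin n → R) (a : Fin m → A) (b : Fin n → B),
    (∀ i, ∑ j, r i j • b j = f (a i)) → ∃ a' : Fin n → A, ∀ i, ∑ j, r i j • a' j = a i

lemma isEquationallyPure_of_tensor_injective {A B : ModuleCat.{u} R} {f : A ⟶ B}
    (hf : Function.Injective ((tensorFunctor (.of Rᵐᵒᵖ (LeftDual A))).map f)) :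
    IsEquationallyPure f := by
  intro m n r a b hab
  let A' := ModuleCat.of Rᵐᵒᵖ (LeftDual A)
  let Φ : (Fin n → A) →+ (Fin m → A) := AddMonoidHom.mk' (fun x i ↦ ∑ j, r i j • x j)
    fun x y ↦ by ext i; simp [Finset.sum_add_distrib]
  have Φ_single (j : Fin n) (x : A) : Φ (Pi.single j x) = fun i ↦ r i j • x := by
    ext i
    change ∑ k, r i k • (Pi.single j x : Fin n → A) k = r i j • x
    rw [Fintype.sum_eq_single j fun k hk ↦ by rw [Pi.single_eq_of_ne hk, smul_zero],
      Pi.single_eq_same]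
  let q := QuotientAddGroup.mk' Φ.range
  suffices q a = 0 by
    obtain ⟨a', ha'⟩ := (QuotientAddGroup.eq_zero_iff a).1 this
    exact ⟨a', congrFun ha'⟩
  refine CharacterModule.eq_zero_of_character_apply fun c ↦ ?_
  let c' : (Fin m → A) →+ AddCircle (1 : ℚ) := AddMonoidHom.comp c q
  let χ (i : Fin m) : A' := c'.comp (AddMonoidHom.single (fun _ ↦ A) i)
  have sum_χ (x : Fin m → A) : ∑ i, χ i (x i) = c' x :=
    (map_sum c' _ _).symm.trans (congrArg c' (Finset.univ_sum_single x))
  have relation (j : Fin n) : ∑ i, MulOpposite.op (r i j) • χ i = 0 := by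
    refine LeftDual.ext fun x ↦ ?_
    calc (∑ i, MulOpposite.op (r i j) • χ i : LeftDual A) x = ∑ i, χ i (r i j • x) :=
          AddMonoidHom.finsetSum_apply _ _ x
      _ = c' (Φ (Pi.single j x)) := by rw [Φ_single, sum_χ]
      _ = 0 := (congrArg c ((QuotientAddGroup.eq_zero_iff _).2 ⟨_, rfl⟩)).trans (map_zero c)
  have tensor_eq_zero : ∑ i, BalancedTensor.mk A' A (χ i) (a i) = 0 := by
    apply hf
    calc BalancedTensor.map A' f (∑ i, BalancedTensor.mk A' A (χ i) (a i))
        = ∑ i, BalancedTensor.mk A' B (χ i) (f (a i)) := map_sum (BalancedTensor.map A' f) _ _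
      _ = ∑ j, BalancedTensor.mk A' B (∑ i, MulOpposite.op (r i j) • χ i) (b j) := by
          simp only [← hab, BalancedTensor.sum_mk_sum_smul]
      _ = 0 := by simp only [relation, map_zero, AddMonoidHom.zero_apply, Finset.sum_const_zero]
      _ = BalancedTensor.map A' f 0 := (map_zero _).symm
  calc c' a = uncurry (toDoubleDual A) (∑ i, BalancedTensor.mk A' A (χ i) (a i)) := by
        rw [map_sum, ← sum_χ]; rfl
    _ = 0 := by rw [tensor_eq_zero, map_zero]

/-- The elements of `N →₀ B` that come from linear relations between the elements of `N`; they are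
the kernel of `(N →₀ B) → N ⊗ B`. -/
def relationSubgroup (N : ModuleCat.{u} Rᵐᵒᵖ) (B : ModuleCat.{u} R) : AddSubgroup (N →₀ B) where
  carrier := {w | ∃ (k : ℕ) (v : Fin k → N →₀ Rᵐᵒᵖ) (b : Fin k → B),
    (∀ j, Finsupp.linearCombination Rᵐᵒᵖ id (v j) = 0) ∧ ∀ n, w n = ∑ j, (v j n).unop • b j}
  zero_mem' := ⟨0, Fin.elim0, Fin.elim0, fun j ↦ j.elim0, by simp⟩
  add_mem' := by
    rintro w w' ⟨k, v, b, hv, hw⟩ ⟨l, v', b', hv', hw'⟩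
    refine ⟨k + l, Fin.append v v', Fin.append b b',
      Fin.addCases (by simpa using hv) (by simpa using hv'), fun n ↦ ?_⟩
    simp [hw, hw', Fin.sum_univ_add]
  neg_mem' := by
    rintro w ⟨k, v, b, hv, hw⟩
    exact ⟨k, v, -b, hv, by simp [hw]⟩

variable {N : ModuleCat.{u} Rᵐᵒᵖ} {A B : ModuleCat.{u} R}

lemma mapRange_smul_mem_relationSubgroup {v : N →₀ Rᵐᵒᵖ}
    (hv : Finsupp.linearCombination Rᵐᵒᵖ id v = 0) (b : B) :
    v.mapRange (fun r ↦ r.unop • b) (zero_smul R b) ∈ relationSubgroup N B :=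
  ⟨1, fun _ ↦ v, fun _ ↦ b, fun _ ↦ hv, by simp⟩

lemma single_add_sub_mem_relationSubgroup (n n' : N) (b : B) :
    Finsupp.single (n + n') b - (Finsupp.single n b + Finsupp.single n' b) ∈
      relationSubgroup N B := by
  convert mapRange_smul_mem_relationSubgroup (N := N)
    (v := .single (n + n') 1 - (.single n 1 + .single n' 1)) (by simp) b using 1
  rw [Finsupp.mapRange_sub (by simp [sub_smul]), Finsupp.mapRange_add (by simp [add_smul])]
  simp

lemma single_smul_sub_mem_relationSubgroup (r : R) (n : N) (b : B) :
    Finsupp.single (MulOpposite.op r • n) b - Finsupp.single n (r • b) ∈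
      relationSubgroup N B := by
  convert mapRange_smul_mem_relationSubgroup (N := N)
    (v := .single (MulOpposite.op r • n) 1 - .single n (MulOpposite.op r)) (by simp) b using 1
  rw [Finsupp.mapRange_sub (by simp [sub_smul])]
  simp

lemma mem_relationSubgroup_of_sum_mk_eq_zero {w : N →₀ B}
    (hw : (w.sum fun n b ↦ BalancedTensor.mk N B n b) = 0) : w ∈ relationSubgroup N B := by
  let π := QuotientAddGroup.mk' (relationSubgroup N B)
  have π_eq {x y : N →₀ B} (h : x - y ∈ relationSubgroup N B) : π x = π y :=
    QuotientAddGroup.eq_iff_sub_mem.2 h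
  let φ : BalancedTensor R N B →+ (N →₀ B) ⧸ relationSubgroup N B := BalancedTensor.lift
    (AddMonoidHom.mk' (fun n ↦ π.comp (Finsupp.singleAddHom n)) fun n n' ↦ AddMonoidHom.ext fun b ↦
      (π_eq (single_add_sub_mem_relationSubgroup n n' b)).trans (map_add π _ _))
    fun r n b ↦ π_eq (single_smul_sub_mem_relationSubgroup r n b)
  refine (QuotientAddGroup.eq_zero_iff w).1 ?_
  calc π w = φ (w.sum fun n b ↦ BalancedTensor.mk N B n b) := by
        conv_lhs => rw [← Finsupp.sum_single w, map_finsuppSum]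
        exact (map_sum φ (fun n ↦ BalancedTensor.mk N B n (w n)) w.support).symm
    _ = 0 := by rw [hw, map_zero]

lemma exists_sum_mk_eq (t : BalancedTensor R N A) :
    ∃ w : N →₀ A, (w.sum fun n a ↦ BalancedTensor.mk N A n a) = t := by
  classical
  induction t using BalancedTensor.induction with
  | h0 => exact ⟨0, Finsupp.sum_zero_index⟩
  | hmk n a => exact ⟨.single n a, Finsupp.sum_single_index (map_zero _)⟩
  | hadd x y hx hy =>
    obtain ⟨⟨w, rfl⟩, ⟨w', rfl⟩⟩ := And.intro hx hy
    exact ⟨w + w', Finsupp.sum_add_index' (by simp) (by simp)⟩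

lemma sum_mk_eq_zero_of_mem_relationSubgroup {w : N →₀ A} (hw : w ∈ relationSubgroup N A) :
    (w.sum fun n a ↦ BalancedTensor.mk N A n a) = 0 := by
  classical
  obtain ⟨k, v, a, hv, hw⟩ := hw
  let T : Finset N := w.support ∪ Finset.univ.biUnion fun j ↦ (v j).support
  have support_subset (j : Fin k) : (v j).support ⊆ T := fun n hn ↦
    Finset.mem_union_right _ (Finset.mem_biUnion.2 ⟨j, Finset.mem_univ j, hn⟩)
  calc w.sum (fun n a ↦ BalancedTensor.mk N A n a)
      = ∑ n ∈ T, BalancedTensor.mk N A n (∑ j, (v j n).unop • a j) := by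
        simp_rw [← hw]
        exact Finsupp.sum_of_support_subset w Finset.subset_union_left _ (by simp)
    _ = ∑ j, BalancedTensor.mk N A (∑ n ∈ T, v j n • n) (a j) :=
        BalancedTensor.sum_mk_sum_smul T Finset.univ _ id a
    _ = 0 := Finset.sum_eq_zero fun j _ ↦ by
        have : ∑ n ∈ T, v j n • n = 0 := by
          rw [← hv j, Finsupp.linearCombination_apply]
          exact (Finsupp.sum_of_support_subset _ (support_subset j) (fun n r ↦ r • n)
            fun n _ ↦ zero_smul Rᵐᵒᵖ n).symm
        rw [this, map_zero, AddMonoidHom.zero_apply]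

lemma IsEquationallyPure.mem_relationSubgroup {f : A ⟶ B} (hf : IsEquationallyPure f)
    {w : N →₀ A} (hw : w.mapRange f (map_zero f.hom) ∈ relationSubgroup N B) :
    w ∈ relationSubgroup N A := by
  classical
  obtain ⟨k, v, b, hv, hw⟩ := hw
  let T : Finset N := w.support ∪ Finset.univ.biUnion fun j ↦ (v j).support
  obtain ⟨a, ha⟩ := hf T.card k (fun i j ↦ (v j (T.equivFin.symm i)).unop)
    (fun i ↦ w (T.equivFin.symm i)) b fun i ↦ (hw _).symm
  refine ⟨k, v, a, hv, fun n ↦ ?_⟩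
  by_cases hn : n ∈ T
  · simpa using (ha (T.equivFin ⟨n, hn⟩)).symm
  · simp only [T, Finset.mem_union, Finsupp.mem_support_iff, Finset.mem_biUnion, Finset.mem_univ,
      true_and, not_or, not_exists, not_not] at hn
    simp [hn.1, hn.2]

lemma IsEquationallyPure.tensor_injective {f : A ⟶ B} (hf : IsEquationallyPure f)
    (N : ModuleCat.{u} Rᵐᵒᵖ) : Function.Injective ((tensorFunctor N).map f) := by
  refine (injective_iff_map_eq_zero (BalancedTensor.map N f)).2 fun t ht ↦ ?_
  obtain ⟨w, rfl⟩ := exists_sum_mk_eq t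
  refine sum_mk_eq_zero_of_mem_relationSubgroup
    (hf.mem_relationSubgroup (mem_relationSubgroup_of_sum_mk_eq_zero (Eq.trans ?_ ht)))
  rw [Finsupp.sum_mapRange_index (by simp)]
  exact (map_sum (BalancedTensor.map N f)
    (fun n ↦ BalancedTensor.mk N A n (w n)) w.support).symm

end EquationalPurity

section FinitelyPresented

variable {R : Type u} [Ring R]

lemma isEquationallyPure_iff_exists_comp_eq {A B : ModuleCat.{u} R} (f : A ⟶ B) :
    IsEquationallyPure f ↔
      ∀ (m n : ℕ) (ρ : ModuleCat.of R (Fin m → R) ⟶ ModuleCat.of R (Fin n → R))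
        (a : ModuleCat.of R (Fin m → R) ⟶ A) (b : ModuleCat.of R (Fin n → R) ⟶ B),
        ρ ≫ b = a ≫ f → ∃ a' : ModuleCat.of R (Fin n → R) ⟶ A, ρ ≫ a' = a := by
  have hom_ext {n : ℕ} {M : ModuleCat.{u} R} {x y : ModuleCat.of R (Fin n → R) ⟶ M}
      (h : ∀ j, x (Pi.single j 1) = y (Pi.single j 1)) : x = y :=
    ModuleCat.hom_ext (LinearMap.pi_ext' fun j ↦ LinearMap.ext_ring (h j))
  have apply_eq_sum {n : ℕ} {M : ModuleCat.{u} R} (x : ModuleCat.of R (Fin n → R) ⟶ M)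
      (v : Fin n → R) : x v = ∑ j, v j • x (Pi.single j 1) := by
    conv_lhs => rw [pi_eq_sum_univ' v, map_sum]
    simp only [map_smul]
  refine ⟨fun hf m n ρ a b h ↦ ?_, fun hf m n r a b h ↦ ?_⟩
  · obtain ⟨a', ha'⟩ := hf m n (fun i ↦ ρ (Pi.single i 1)) (fun i ↦ a (Pi.single i 1))
      (fun j ↦ b (Pi.single j 1)) fun i ↦
        (apply_eq_sum b _).symm.trans (ConcreteCategory.congr_hom h (Pi.single i 1))
    exact ⟨ModuleCat.ofHom (Fintype.linearCombination R a'), hom_ext ha'⟩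
  · obtain ⟨a', ha'⟩ := hf m n (ModuleCat.ofHom (Fintype.linearCombination R r))
      (ModuleCat.ofHom (Fintype.linearCombination R a))
      (ModuleCat.ofHom (Fintype.linearCombination R b)) <| hom_ext fun i ↦ by
        simpa [Fintype.linearCombination_apply] using h i
    refine ⟨fun j ↦ a' (Pi.single j 1), fun i ↦ ?_⟩
    refine (apply_eq_sum a' (r i)).symm.trans ?_
    simpa using ConcreteCategory.congr_hom ha' (Pi.single i 1)

lemma isPureProjective_of_finitePresentation (F : ModuleCat.{u} R)
    [Module.FinitePresentation R F] : IsPureProjective F := fun S hS f ↦ by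
  have := hS.shortExact.mono_f
  have hpure : IsEquationallyPure S.f := isEquationallyPure_of_tensor_injective
    ((AddCommGrpCat.mono_iff_injective _).1 (hS.tensor _).mono_f)
  obtain ⟨n, m, p, ρ, hp, hρ⟩ := Module.FinitePresentation.exists_fin' R F
  let T := ShortComplex.mk (ModuleCat.ofHom ρ) (ModuleCat.ofHom p)
    (ModuleCat.hom_ext hρ.linearMap_comp_eq_zero)
  have hT : T.Exact := (ShortComplex.ShortExact.moduleCat_exact_iff_function_exact T).2 hρ
  have : Epi T.g := (ModuleCat.epi_iff_surjective _).2 hp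
  obtain ⟨b, hb⟩ := Module.projective_lifting_property S.g.hom (T.g ≫ f).hom
    hS.shortExact.moduleCat_surjective_g
  replace hb : ModuleCat.ofHom b ≫ S.g = T.g ≫ f := ModuleCat.hom_ext hb
  have relations_lift : (T.f ≫ ModuleCat.ofHom b) ≫ S.g = 0 := by
    rw [Category.assoc, hb, T.zero_assoc, zero_comp]
  obtain ⟨a', ha'⟩ := (isEquationallyPure_iff_exists_comp_eq S.f).1 hpure m n T.f
    (hS.shortExact.exact.lift _ relations_lift) _ (hS.shortExact.exact.lift_f _ _).symm
  have corrected : T.f ≫ (ModuleCat.ofHom b - a' ≫ S.f) = 0 := by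
    rw [Preadditive.comp_sub, ← Category.assoc, ha', hS.shortExact.exact.lift_f, sub_self]
  refine ⟨hT.desc _ corrected, ?_⟩
  rw [← cancel_epi T.g, hT.g_desc_assoc, Preadditive.sub_comp, hb, Category.assoc, S.zero,
    comp_zero, sub_zero]

lemma finitePresentation_cokernel {m n : ℕ}
    (ρ : ModuleCat.of R (Fin m → R) ⟶ ModuleCat.of R (Fin n → R)) :
    Module.FinitePresentation R (cokernel ρ : ModuleCat.{u} R) := by
  let K := LinearMap.range ρ.hom
  have fg : K.FG := Module.Finite.iff_fg.1 (Module.Finite.range ρ.hom)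
  have : Module.FinitePresentation R ((Fin n → R) ⧸ K) :=
    Module.finitePresentation_of_surjective K.mkQ K.mkQ_surjective (by rwa [K.ker_mkQ])
  exact .of_equiv (ModuleCat.cokernelIsoRangeQuotient ρ).symm.toLinearEquiv

lemma isPureExact_of_lift {S : ShortComplex (ModuleCat.{u} R)} (hS : S.ShortExact)
    (lift : ∀ (F : ModuleCat.{u} R) [Module.FinitePresentation R F] (g : F ⟶ S.X₃),
      ∃ g' : F ⟶ S.X₂, g' ≫ S.g = g) : IsPureExact S := by
  have := hS.mono_f
  refine isPureExact_of_injective hS (IsEquationallyPure.tensor_injective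
    ((isEquationallyPure_iff_exists_comp_eq _).2 fun m n ρ a b hab ↦ ?_))
  have := finitePresentation_cokernel ρ
  obtain ⟨g, hg⟩ := lift (cokernel ρ) (cokernel.desc ρ (b ≫ S.g)
    (by rw [reassoc_of% hab, S.zero, comp_zero]))
  have hbg : (b - cokernel.π ρ ≫ g) ≫ S.g = 0 := by
    rw [Preadditive.sub_comp, Category.assoc, hg, cokernel.π_desc, sub_self]
  refine ⟨hS.exact.lift _ hbg, ?_⟩
  rw [← cancel_mono S.f, Category.assoc, hS.exact.lift_f, Preadditive.comp_sub, hab,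
    cokernel.condition_assoc, zero_comp, sub_zero]

lemma isPureProjective_sigma {ι : Type u} {P : ι → ModuleCat.{u} R}
    (hP : ∀ i, IsPureProjective (P i)) : IsPureProjective (∐ P) := fun S hS f ↦ by
  choose g hg using fun i ↦ hP i S hS (Sigma.ι P i ≫ f)
  exact ⟨Sigma.desc g, Sigma.hom_ext _ _ fun i ↦ by rw [Sigma.ι_desc_assoc, hg]⟩

/-- The maps to `A` from the cokernels of maps between finite free modules. These index the
summands of a pure projective module covering `A`; unlike all the finitely presented modules over
`A`, they form a type in the universe `u`. -/
structure PresentedOver (A : ModuleCat.{u} R) : Type u where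
  {m : ℕ}
  {n : ℕ}
  ρ : ModuleCat.of R (Fin m → R) ⟶ ModuleCat.of R (Fin n → R)
  hom : cokernel ρ ⟶ A

lemma exists_presentedOver {F A : ModuleCat.{u} R} [Module.FinitePresentation R F] (g : F ⟶ A) :
    ∃ (x : PresentedOver A) (e : F ⟶ cokernel x.ρ), e ≫ x.hom = g := by
  obtain ⟨n, m, p, ρ, hp, hρ⟩ := Module.FinitePresentation.exists_fin' R F
  let T := ShortComplex.mk (ModuleCat.ofHom ρ) (ModuleCat.ofHom p)
    (ModuleCat.hom_ext hρ.linearMap_comp_eq_zero)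
  have hT : T.Exact := (ShortComplex.ShortExact.moduleCat_exact_iff_function_exact T).2 hρ
  have : Epi T.g := (ModuleCat.epi_iff_surjective _).2 hp
  refine ⟨⟨T.f, cokernel.desc _ (T.g ≫ g) (by rw [T.zero_assoc, zero_comp])⟩,
    hT.desc (cokernel.π T.f) (cokernel.condition _), ?_⟩
  rw [← cancel_epi T.g, hT.g_desc_assoc, cokernel.π_desc]

lemma exists_isPureEpi (A : ModuleCat.{u} R) :
    ∃ (P : ModuleCat.{u} R) (π : P ⟶ A), IsPureProjective P ∧ IsPureEpi π := by
  let P := ∐ fun x : PresentedOver A ↦ cokernel x.ρ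
  let π : P ⟶ A := Sigma.desc fun x ↦ x.hom
  have lift (F : ModuleCat.{u} R) [Module.FinitePresentation R F] (g : F ⟶ A) :
      ∃ g' : F ⟶ P, g' ≫ π = g := by
    obtain ⟨x, e, he⟩ := exists_presentedOver g
    exact ⟨e ≫ Sigma.ι (fun x : PresentedOver A ↦ cokernel x.ρ) x, by simp [π, he]⟩
  have : Epi π := (ModuleCat.epi_iff_surjective π).2 fun a ↦ by
    obtain ⟨g, hg⟩ := lift (ModuleCat.of R R) (ModuleCat.ofHom (LinearMap.toSpanSingleton R A a))
    exact ⟨g 1, by simpa using ConcreteCategory.congr_hom hg 1⟩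
  refine ⟨P, π, isPureProjective_sigma fun x ↦ ?_, kernel π, kernel.ι π, kernel.condition π,
    isPureExact_of_lift { exact := ShortComplex.exact_kernel π } lift⟩
  have := finitePresentation_cokernel x.ρ
  exact isPureProjective_of_finitePresentation _

end FinitelyPresented

section Verdier

variable {C : Type*} [Category* C] [HasZeroObject C] [HasShift C ℤ] [Preadditive C]
  [∀ n : ℤ, (shiftFunctor C n).Additive] [Pretriangulated C]

instance [IsTriangulated C] (E : ObjectProperty C) [E.IsTriangulated]
    [E.IsClosedUnderIsomorphisms] : E.trW.HasTwoOutOfThreeProperty where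
  of_postcomp f g hg hfg := by
    obtain ⟨_, _, _, hTf⟩ := distinguished_cocone_triangle f
    obtain ⟨_, _, _, hTg⟩ := distinguished_cocone_triangle g
    obtain ⟨_, _, _, hTfg⟩ := distinguished_cocone_triangle (f ≫ g)
    have cone_mem := E.ext_of_isTriangulatedClosed₁ _
      (Triangulated.someOctahedron rfl hTf hTg hTfg).mem
      ((E.trW_iff_of_distinguished _ hTfg).1 hfg) ((E.trW_iff_of_distinguished _ hTg).1 hg)
    exact .mk E hTf cone_mem
  of_precomp f g hf hfg := by
    obtain ⟨_, _, _, hTf⟩ := distinguished_cocone_triangle f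
    obtain ⟨_, _, _, hTg⟩ := distinguished_cocone_triangle g
    obtain ⟨_, _, _, hTfg⟩ := distinguished_cocone_triangle (f ≫ g)
    have cone_mem := E.ext_of_isTriangulatedClosed₃ _
      (Triangulated.someOctahedron rfl hTf hTg hTfg).mem
      ((E.trW_iff_of_distinguished _ hTf).1 hf) ((E.trW_iff_of_distinguished _ hTfg).1 hfg)
    exact .mk E hTg cone_mem

/-- The objects with a left resolution: they receive a morphism from an object of `P` whose cone
is in `E`. -/
def leftResolved (E P : ObjectProperty C) : ObjectProperty C :=
  fun X ↦ ∃ (Q : C) (s : Q ⟶ X), P Q ∧ E.trW s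

/-- The objects with a right resolution: they map to an object of `P` by a morphism whose cone
is in `E`. -/
def rightResolved (E P : ObjectProperty C) : ObjectProperty C :=
  fun X ↦ ∃ (Q : C) (s : X ⟶ Q), P Q ∧ E.trW s

section Resolved

variable {E P : ObjectProperty C}

lemma le_leftResolved [E.ContainsZero] : P ≤ leftResolved E P :=
  fun X hX ↦ ⟨X, 𝟙 X, hX, E.trW_of_isIso _⟩

lemma le_rightResolved [E.ContainsZero] : P ≤ rightResolved E P :=
  fun X hX ↦ ⟨X, 𝟙 X, hX, E.trW_of_isIso _⟩

variable [IsTriangulated C] [E.IsTriangulated]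

instance : (leftResolved E P).IsClosedUnderIsomorphisms where
  of_iso e := fun ⟨Q, s, hQ, hs⟩ ↦ ⟨Q, s ≫ e.hom, hQ, E.trW.comp_mem _ _ hs (E.trW_of_isIso _)⟩

instance : (rightResolved E P).IsClosedUnderIsomorphisms where
  of_iso e := fun ⟨Q, s, hQ, hs⟩ ↦ ⟨Q, e.inv ≫ s, hQ, E.trW.comp_mem _ _ (E.trW_of_isIso _) hs⟩

variable [P.IsTriangulated]

/-- Morphisms between left resolved objects lift to their resolutions by orthogonality, and the
cone of the lift resolves the cone. -/
lemma isTriangulated_leftResolved (hP : P ≤ E.leftOrthogonal) :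
    (leftResolved E P).IsTriangulated := by
  have : (leftResolved E P).ContainsZero := by
    obtain ⟨Z, hZ, hPZ⟩ := P.exists_prop_of_containsZero
    exact ⟨Z, hZ, le_leftResolved _ hPZ⟩
  have : (leftResolved E P).IsStableUnderShift ℤ := ⟨fun n ↦ ⟨fun X ⟨Q, s, hQ, hs⟩ ↦
    ⟨Q⟦n⟧, s⟦n⟧', P.le_shift n _ hQ, hs.shift n⟩⟩⟩
  have : (leftResolved E P).IsTriangulatedClosed₃ := .mk' fun T hT ⟨Q₁, s₁, hQ₁, hs₁⟩
      ⟨Q₂, s₂, hQ₂, hs₂⟩ ↦ by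
    have hQ₁_colocal : E.trW.isColocal Q₁ := by
      rw [ObjectProperty.isColocal_trW]
      exact hP _ hQ₁
    obtain ⟨f, hf⟩ := (hQ₁_colocal _ hs₂).2 (s₁ ≫ T.mor₁)
    obtain ⟨Q₃, hQ₃, g, k, hT'⟩ := P.distinguished_cocone_triangle f hQ₁ hQ₂
    obtain ⟨c, hc, -⟩ := MorphismProperty.compatible_with_triangulation (W := E.trW) _ _ hT' hT
      s₁ s₂ hs₁ hs₂ hf
    exact ⟨Q₃, c, hQ₃, hc⟩
  exact { toIsTriangulatedClosed₂ := .of_isTriangulatedClosed₃ }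

lemma isTriangulated_rightResolved (hP : P ≤ E.rightOrthogonal) :
    (rightResolved E P).IsTriangulated := by
  have : (rightResolved E P).ContainsZero := by
    obtain ⟨Z, hZ, hPZ⟩ := P.exists_prop_of_containsZero
    exact ⟨Z, hZ, le_rightResolved _ hPZ⟩
  have : (rightResolved E P).IsStableUnderShift ℤ := ⟨fun n ↦ ⟨fun X ⟨Q, s, hQ, hs⟩ ↦
    ⟨Q⟦n⟧, s⟦n⟧', P.le_shift n _ hQ, hs.shift n⟩⟩⟩
  have : (rightResolved E P).IsTriangulatedClosed₃ := .mk' fun T hT ⟨Q₁, s₁, hQ₁, hs₁⟩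
      ⟨Q₂, s₂, hQ₂, hs₂⟩ ↦ by
    have hQ₂_local : E.trW.isLocal Q₂ := by
      rw [ObjectProperty.isLocal_trW]
      exact hP _ hQ₂
    obtain ⟨f, hf⟩ := (hQ₂_local _ hs₁).2 (T.mor₁ ≫ s₂)
    obtain ⟨Q₃, hQ₃, g, k, hT'⟩ := P.distinguished_cocone_triangle f hQ₁ hQ₂
    obtain ⟨c, hc, -⟩ := MorphismProperty.compatible_with_triangulation (W := E.trW) _ _ hT hT'
      s₁ s₂ hs₁ hs₂ hf.symm
    exact ⟨Q₃, c, hQ₃, hc⟩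
  exact { toIsTriangulatedClosed₂ := .of_isTriangulatedClosed₃ }

end Resolved

/-- The objects of `P` are left resolutions, relative to `E`, of the objects of `A`, and every
morphism from `P` to `A` factors, up to a cone in `E`, through an object of `A`. -/
structure IsLeftResolving (E A P : ObjectProperty C) : Prop where
  le_leftOrthogonal : P ≤ E.leftOrthogonal
  le_leftResolved : A ≤ leftResolved E P
  exists_fac {Q Y : C} (f : Q ⟶ Y) (hQ : P Q) (hY : A Y) :
    ∃ (Z : C) (s : Q ⟶ Z) (g : Z ⟶ Y), A Z ∧ E.trW s ∧ s ≫ g = f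

/-- The objects of `P` are right resolutions, relative to `E`, of the objects of `A`, and every
morphism from `A` to `P` factors, up to a cone in `E`, through an object of `A`. -/
structure IsRightResolving (E A P : ObjectProperty C) : Prop where
  le_rightOrthogonal : P ≤ E.rightOrthogonal
  le_rightResolved : A ≤ rightResolved E P
  exists_fac {X Q : C} (f : X ⟶ Q) (hX : A X) (hQ : P Q) :
    ∃ (Z : C) (g : X ⟶ Z) (s : Z ⟶ Q), A Z ∧ E.trW s ∧ g ≫ s = f

lemma IsLeftResolving.exists_fac_pair {E A P : ObjectProperty C} [A.IsTriangulated]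
    (h : IsLeftResolving E A P) {Q : C} {X Y : A.FullSubcategory} (f : Q ⟶ X.obj) (g : Q ⟶ Y.obj)
    (hQ : P Q) : ∃ (Z : A.FullSubcategory) (s : Q ⟶ Z.obj) (f' : Z ⟶ X) (g' : Z ⟶ Y),
      E.trW s ∧ s ≫ f'.hom = f ∧ s ≫ g'.hom = g := by
  obtain ⟨Z, s, k, hZ, hs, hk⟩ := h.exists_fac
    (f ≫ A.ι.map (biprod.inl : X ⟶ X ⊞ Y) + g ≫ A.ι.map (biprod.inr : Y ⟶ X ⊞ Y)) hQ
    (X ⊞ Y).property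
  refine ⟨⟨Z, hZ⟩, s, A.homMk (k ≫ A.ι.map biprod.fst), A.homMk (k ≫ A.ι.map biprod.snd), hs,
    ?_, ?_⟩
  all_goals
    simp only [ObjectProperty.homMk_hom, reassoc_of% hk, Preadditive.add_comp, Category.assoc,
      ← A.ι.map_comp]
    simp

lemma IsRightResolving.exists_fac_pair {E A P : ObjectProperty C} [A.IsTriangulated]
    (h : IsRightResolving E A P) {Q : C} {X Y : A.FullSubcategory} (f : X.obj ⟶ Q) (g : Y.obj ⟶ Q)
    (hQ : P Q) : ∃ (Z : A.FullSubcategory) (s : Z.obj ⟶ Q) (f' : X ⟶ Z) (g' : Y ⟶ Z),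
      E.trW s ∧ f'.hom ≫ s = f ∧ g'.hom ≫ s = g := by
  obtain ⟨Z, k, s, hZ, hs, hk⟩ := h.exists_fac
    (A.ι.map (biprod.fst : X ⊞ Y ⟶ X) ≫ f + A.ι.map (biprod.snd : X ⊞ Y ⟶ Y) ≫ g)
    (X ⊞ Y).property hQ
  refine ⟨⟨Z, hZ⟩, s, A.homMk (A.ι.map biprod.inl ≫ k), A.homMk (A.ι.map biprod.inr ≫ k), hs,
    ?_, ?_⟩
  all_goals
    simp only [ObjectProperty.homMk_hom, Category.assoc, hk, Preadditive.comp_add,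
      ← A.ι.map_comp_assoc]
    simp

variable (E A : ObjectProperty C) [E.IsClosedUnderIsomorphisms]
  [A.IsTriangulated] {D₁ : Type*} [Category* D₁] (L₁ : A.FullSubcategory ⥤ D₁)
  [L₁.IsLocalization (E.inverseImage A.ι).trW]

/-- The functor `A/(A ⊓ E) ⥤ C/E` between Verdier quotients induced by the inclusion of `A`,
where `L₁` is any model of the first quotient. -/
def verdierFunctor : D₁ ⥤ E.trW.Localization :=
  Localization.lift (A.ι ⋙ E.trW.Q) (E.inverseImage_trW_isInverted A.ι E.trW.Q) L₁

/-- The functor `verdierFunctor` extends the inclusion of `A`. -/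
def verdierFunctorIso : L₁ ⋙ verdierFunctor E A L₁ ≅ A.ι ⋙ E.trW.Q := Localization.fac _ _ _

instance : Localization.Lifting L₁ (E.inverseImage A.ι).trW (A.ι ⋙ E.trW.Q)
    (verdierFunctor E A L₁) :=
  ⟨verdierFunctorIso E A L₁⟩

variable {E A} in
lemma IsLeftResolving.essImage_verdierFunctor {P : ObjectProperty C}
    (h : IsLeftResolving E A P) :
    (verdierFunctor E A L₁).essImage = (P.ι ⋙ E.trW.Q).essImage := by
  have : L₁.EssSurj := Localization.essSurj L₁ (E.inverseImage A.ι).trW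
  let e := verdierFunctorIso E A L₁
  ext W
  constructor
  · rintro ⟨X, ⟨i⟩⟩
    obtain ⟨Q, r, hQ, hr⟩ := h.le_leftResolved _ (L₁.objPreimage X).property
    have := Localization.inverts E.trW.Q _ r hr
    exact ⟨⟨Q, hQ⟩, ⟨asIso (E.trW.Q.map r) ≪≫ (e.app (L₁.objPreimage X)).symm ≪≫
      (verdierFunctor E A L₁).mapIso (L₁.objObjPreimageIso X) ≪≫ i⟩⟩
  · rintro ⟨Q, ⟨i⟩⟩
    obtain ⟨Y, -, hY⟩ := A.exists_prop_of_containsZero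
    obtain ⟨Z, s, -, hZ, hs, -⟩ := h.exists_fac (0 : Q.obj ⟶ Y) Q.property hY
    have := Localization.inverts E.trW.Q _ s hs
    exact ⟨L₁.obj ⟨Z, hZ⟩, ⟨e.app ⟨Z, hZ⟩ ≪≫ (asIso (E.trW.Q.map s)).symm ≪≫ i⟩⟩

variable {E A} in
lemma IsRightResolving.essImage_verdierFunctor {P : ObjectProperty C}
    (h : IsRightResolving E A P) :
    (verdierFunctor E A L₁).essImage = (P.ι ⋙ E.trW.Q).essImage := by
  have : L₁.EssSurj := Localization.essSurj L₁ (E.inverseImage A.ι).trW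
  let e := verdierFunctorIso E A L₁
  ext W
  constructor
  · rintro ⟨X, ⟨i⟩⟩
    obtain ⟨Q, r, hQ, hr⟩ := h.le_rightResolved _ (L₁.objPreimage X).property
    have := Localization.inverts E.trW.Q _ r hr
    exact ⟨⟨Q, hQ⟩, ⟨(asIso (E.trW.Q.map r)).symm ≪≫ (e.app (L₁.objPreimage X)).symm ≪≫
      (verdierFunctor E A L₁).mapIso (L₁.objObjPreimageIso X) ≪≫ i⟩⟩
  · rintro ⟨Q, ⟨i⟩⟩
    obtain ⟨Y, -, hY⟩ := A.exists_prop_of_containsZero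
    obtain ⟨Z, -, s, hZ, hs, -⟩ := h.exists_fac (0 : Y ⟶ Q.obj) hY Q.property
    have := Localization.inverts E.trW.Q _ s hs
    exact ⟨L₁.obj ⟨Z, hZ⟩, ⟨e.app ⟨Z, hZ⟩ ≪≫ asIso (E.trW.Q.map s) ≪≫ i⟩⟩

variable [IsTriangulated C] [E.IsTriangulated]

section Triangulated

variable [HasShift D₁ ℤ] [L₁.CommShift ℤ]

instance : (verdierFunctor E A L₁).CommShift ℤ :=
  Functor.commShiftOfLocalization L₁ (E.inverseImage A.ι).trW ℤ (A.ι ⋙ E.trW.Q) _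

instance [HasZeroObject D₁] [Preadditive D₁] [∀ n : ℤ, (shiftFunctor D₁ n).Additive]
    [Pretriangulated D₁] [L₁.IsTriangulated] : (verdierFunctor E A L₁).IsTriangulated := by
  have : NatTrans.CommShift (verdierFunctorIso E A L₁).hom ℤ :=
    NatTrans.commShift_iso_hom_of_localization L₁ (E.inverseImage A.ι).trW ℤ (A.ι ⋙ E.trW.Q) _
  have : L₁.mapArrow.EssSurj := Localization.essSurj_mapArrow L₁ (E.inverseImage A.ι).trW
  exact Functor.isTriangulated_of_precomp_iso (verdierFunctorIso E A L₁)

end Triangulated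

lemma map_eq_zero_of_verdierFunctor_map_eq_zero {X Y : A.FullSubcategory} (f : X ⟶ Y)
    (hf : (verdierFunctor E A L₁).map (L₁.map f) = 0) : E.trW.Q.map f.hom = 0 := by
  have naturality := (verdierFunctorIso E A L₁).hom.naturality f
  dsimp at naturality
  rwa [hf, zero_comp, eq_comm, ← comp_zero, cancel_epi] at naturality

instance [Preadditive D₁] [L₁.Additive] : (verdierFunctor E A L₁).Additive := by
  rw [Localization.functor_additive_iff L₁ (E.inverseImage A.ι).trW]
  exact Functor.additive_of_iso (verdierFunctorIso E A L₁).symm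

variable {E A} {P : ObjectProperty C}

namespace IsLeftResolving

/-- A morphism `φ` between the images of `X` and `Y` is, on a resolution `r : Q ⟶ X`, given by
some `k : Q ⟶ Y`; both `r` and `k` factor through `s : Q ⟶ Z` with `Z` in `A`, and
`X ⟵ Z ⟶ Y` is a roof in `A` representing `φ`. -/
lemma full_verdierFunctor (h : IsLeftResolving E A P) : (verdierFunctor E A L₁).Full := by
  have : L₁.EssSurj := Localization.essSurj L₁ (E.inverseImage A.ι).trW
  let e := verdierFunctorIso E A L₁
  refine (verdierFunctor E A L₁).full_of_comp_essSurj L₁ fun X Y φ ↦ ?_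
  obtain ⟨Q, r, hQ, hr⟩ := h.le_leftResolved _ X.property
  obtain ⟨k, hk⟩ := ((h.le_leftOrthogonal _ hQ).map_bijective_of_isTriangulated E.trW.Q Y.obj).2
    (E.trW.Q.map r ≫ e.inv.app X ≫ φ ≫ e.hom.app Y)
  obtain ⟨Z, s, t, g, hs, rfl, rfl⟩ := h.exists_fac_pair r k hQ
  have ht : (E.inverseImage A.ι).trW t :=
    (E.inverseImage_trW_iff A.ι t).2 (E.trW.of_precomp _ _ hs hr)
  have := Localization.inverts L₁ _ t ht
  have := Localization.inverts E.trW.Q _ s hs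
  have roof : E.trW.Q.map g.hom = E.trW.Q.map t.hom ≫ e.inv.app X ≫ φ ≫ e.hom.app Y := by
    rw [← cancel_epi (E.trW.Q.map s), ← Functor.map_comp, hk, Functor.map_comp, Category.assoc]
  refine ⟨inv (L₁.map t) ≫ L₁.map g, ?_⟩
  rw [Functor.map_comp, Functor.map_inv, IsIso.inv_comp_eq, ← cancel_mono (e.hom.app Y)]
  have ht' := e.hom.naturality t
  have hg := e.hom.naturality g
  dsimp at ht' hg ⊢
  rw [hg, Category.assoc, roof, ← reassoc_of% ht']
  simp

lemma faithful_verdierFunctor [Preadditive D₁] [L₁.Additive] (h : IsLeftResolving E A P) :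
    (verdierFunctor E A L₁).Faithful := by
  refine Functor.faithful_of_comp_cancel_zero_of_hasLeftCalculusOfFractions L₁
    (E.inverseImage A.ι).trW _ (fun X Y f hf ↦ ?_)
  replace hf := map_eq_zero_of_verdierFunctor_map_eq_zero E A L₁ f hf
  obtain ⟨Q, r, hQ, hr⟩ := h.le_leftResolved _ X.property
  have hrf : r ≫ f.hom = 0 :=
    ((h.le_leftOrthogonal _ hQ).map_bijective_of_isTriangulated E.trW.Q Y.obj).1 (by simp [hf])
  obtain ⟨F, hF, i, _, hT⟩ := A.distinguished_cocone_triangle₁ f.hom X.property Y.property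
  obtain ⟨q, rfl⟩ : ∃ q : Q ⟶ F, r = q ≫ i := Triangle.coyoneda_exact₂ _ hT r hrf
  obtain ⟨Z, s, q', hZ, hs, rfl⟩ := h.exists_fac q hQ hF
  let t : (⟨Z, hZ⟩ : A.FullSubcategory) ⟶ X := A.homMk (q' ≫ i)
  have ht : (E.inverseImage A.ι).trW t := (E.inverseImage_trW_iff A.ι t).2
    (E.trW.of_precomp s _ hs (by simpa [t] using hr))
  have htf : t ≫ f = 0 := by
    have hif : i ≫ f.hom = 0 := comp_distTriang_mor_zero₁₂ _ hT
    ext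
    simp [t, hif]
  have := Localization.inverts L₁ _ t ht
  rw [← cancel_epi (L₁.map t), ← L₁.map_comp, htf, L₁.map_zero, comp_zero]

end IsLeftResolving

namespace IsRightResolving

lemma full_verdierFunctor (h : IsRightResolving E A P) : (verdierFunctor E A L₁).Full := by
  have : L₁.EssSurj := Localization.essSurj L₁ (E.inverseImage A.ι).trW
  let e := verdierFunctorIso E A L₁
  refine (verdierFunctor E A L₁).full_of_comp_essSurj L₁ fun X Y φ ↦ ?_
  obtain ⟨Q, r, hQ, hr⟩ := h.le_rightResolved _ Y.property
  obtain ⟨k, hk⟩ := ((h.le_rightOrthogonal _ hQ).map_bijective_of_isTriangulated E.trW.Q X.obj).2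
    (e.inv.app X ≫ φ ≫ e.hom.app Y ≫ E.trW.Q.map r)
  obtain ⟨Z, s, t, g, hs, rfl, rfl⟩ := h.exists_fac_pair r k hQ
  have ht : (E.inverseImage A.ι).trW t :=
    (E.inverseImage_trW_iff A.ι t).2 (E.trW.of_postcomp _ _ hs hr)
  have := Localization.inverts L₁ _ t ht
  have := Localization.inverts E.trW.Q _ s hs
  have roof : E.trW.Q.map g.hom = e.inv.app X ≫ φ ≫ e.hom.app Y ≫ E.trW.Q.map t.hom := by
    rw [← cancel_mono (E.trW.Q.map s), ← Functor.map_comp, hk, Functor.map_comp]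
    simp only [Category.assoc]
  refine ⟨L₁.map g ≫ inv (L₁.map t), ?_⟩
  rw [Functor.map_comp, Functor.map_inv, IsIso.comp_inv_eq, ← cancel_mono (e.hom.app _)]
  have ht' := e.hom.naturality t
  have hg := e.hom.naturality g
  dsimp at ht' hg ⊢
  rw [hg, Category.assoc, roof, ht']
  simp

lemma faithful_verdierFunctor [Preadditive D₁] [L₁.Additive] (h : IsRightResolving E A P) :
    (verdierFunctor E A L₁).Faithful := by
  refine Functor.faithful_of_comp_cancel_zero_of_hasLeftCalculusOfFractions L₁
    (E.inverseImage A.ι).trW _ (fun X Y f hf ↦ ?_)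
  replace hf := map_eq_zero_of_verdierFunctor_map_eq_zero E A L₁ f hf
  obtain ⟨Q, r, hQ, hr⟩ := h.le_rightResolved _ Y.property
  have hfr : f.hom ≫ r = 0 :=
    ((h.le_rightOrthogonal _ hQ).map_bijective_of_isTriangulated E.trW.Q X.obj).1 (by simp [hf])
  obtain ⟨F, hF, i, _, hT⟩ := A.distinguished_cocone_triangle f.hom X.property Y.property
  obtain ⟨q, rfl⟩ : ∃ q : F ⟶ Q, r = i ≫ q := Triangle.yoneda_exact₂ _ hT r hfr
  obtain ⟨Z, q', s, hZ, hs, rfl⟩ := h.exists_fac q hF hQ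
  let t : Y ⟶ (⟨Z, hZ⟩ : A.FullSubcategory) := A.homMk (i ≫ q')
  have ht : (E.inverseImage A.ι).trW t := (E.inverseImage_trW_iff A.ι t).2
    (E.trW.of_postcomp _ s hs (by simpa [t] using hr))
  have hft : f ≫ t = 0 := by
    have hfi : f.hom ≫ i = 0 := comp_distTriang_mor_zero₁₂ _ hT
    ext
    simp [t, reassoc_of% hfi]
  have := Localization.inverts L₁ _ t ht
  rw [← cancel_mono (L₁.map t), ← L₁.map_comp, hft, L₁.map_zero, zero_comp]

end IsRightResolving

end Verdier

section TriangleEquivalent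

variable {D₁ D₂ D : Type*} [Category* D₁] [Category* D₂] [Category* D] [HasZeroObject D₁]
  [HasZeroObject D₂] [HasZeroObject D] [Preadditive D₁] [Preadditive D₂] [Preadditive D]
  [HasShift D₁ ℤ] [HasShift D₂ ℤ] [HasShift D ℤ] [∀ n : ℤ, (shiftFunctor D₁ n).Additive]
  [∀ n : ℤ, (shiftFunctor D₂ n).Additive] [∀ n : ℤ, (shiftFunctor D n).Additive]
  [Pretriangulated D₁] [Pretriangulated D₂] [Pretriangulated D]

lemma triangleEquivalent_inverse (G : D₂ ⥤ D) [hG : G.CommShift ℤ] [hG' : G.IsTriangulated]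
    [G.IsEquivalence] : TriangleEquivalent D D₂ := by
  let _ : G.asEquivalence.functor.CommShift ℤ := hG
  have : G.asEquivalence.functor.IsTriangulated := hG'
  let _ := G.asEquivalence.commShiftInverse ℤ
  have := G.asEquivalence.commShift_of_functor ℤ
  exact ⟨G.asEquivalence.inverse, inferInstance, inferInstance,
    G.asEquivalence.toAdjunction.isTriangulated_rightAdjoint⟩

lemma triangleEquivalent_of_essImage_eq (F₁ : D₁ ⥤ D) (F₂ : D₂ ⥤ D) [F₁.CommShift ℤ]
    [F₂.CommShift ℤ] [F₁.IsTriangulated] [F₂.IsTriangulated] [F₁.Full] [F₁.Faithful]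
    [F₂.Full] [F₂.Faithful] (h : F₁.essImage = F₂.essImage) : TriangleEquivalent D₁ D₂ := by
  let G₁ : D₁ ⥤ F₂.essImage.FullSubcategory :=
    F₂.essImage.lift F₁ fun X ↦ h.le _ (F₁.obj_mem_essImage X)
  let G₂ : D₂ ⥤ F₂.essImage.FullSubcategory := F₂.essImage.lift F₂ F₂.obj_mem_essImage
  have : G₁.EssSurj := ⟨fun Y ↦ by
    obtain ⟨X, ⟨e⟩⟩ : F₁.essImage Y.obj := h.ge _ Y.property
    exact ⟨X, ⟨F₂.essImage.isoMk e⟩⟩⟩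
  have : G₂.EssSurj := ⟨fun Y ↦ by
    obtain ⟨X, ⟨e⟩⟩ := Y.property
    exact ⟨X, ⟨F₂.essImage.isoMk e⟩⟩⟩
  have : G₁.IsEquivalence := { }
  have : G₂.IsEquivalence := { }
  obtain ⟨G, _, _, _⟩ := triangleEquivalent_inverse G₂
  exact ⟨G₁ ⋙ G, inferInstance, inferInstance, inferInstance⟩

variable {C : Type*} [Category* C] [HasZeroObject C] [HasShift C ℤ] [Preadditive C]
  [∀ n : ℤ, (shiftFunctor C n).Additive] [Pretriangulated C] [IsTriangulated C]
  {E A P : ObjectProperty C} [E.IsTriangulated] [E.IsClosedUnderIsomorphisms]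
  [A.IsTriangulated] [P.IsTriangulated] (L₁ : A.FullSubcategory ⥤ D₁)
  [L₁.IsLocalization (E.inverseImage A.ι).trW] [L₁.CommShift ℤ] [L₁.IsTriangulated]

include L₁ in
lemma IsLeftResolving.triangleEquivalent (h : IsLeftResolving E A P) :
    TriangleEquivalent D₁ P.FullSubcategory := by
  have := h.full_verdierFunctor L₁
  have := h.faithful_verdierFunctor L₁
  have bijective (X Y : P.FullSubcategory) : Function.Bijective ((P.ι ⋙ E.trW.Q).map (Y := Y)) :=
    ((h.le_leftOrthogonal _ X.property).map_bijective_of_isTriangulated E.trW.Q Y.obj).comp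
      (P.fullyFaithfulι.map_bijective X Y)
  have : (P.ι ⋙ E.trW.Q).Full := ⟨fun {X Y} ↦ (bijective X Y).2⟩
  have : (P.ι ⋙ E.trW.Q).Faithful := ⟨fun {X Y} ↦ @(bijective X Y).1⟩
  exact triangleEquivalent_of_essImage_eq _ _ (h.essImage_verdierFunctor L₁)

include L₁ in
lemma IsRightResolving.triangleEquivalent (h : IsRightResolving E A P) :
    TriangleEquivalent D₁ P.FullSubcategory := by
  have := h.full_verdierFunctor L₁
  have := h.faithful_verdierFunctor L₁
  have bijective (X Y : P.FullSubcategory) : Function.Bijective ((P.ι ⋙ E.trW.Q).map (X := X)) :=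
    ((h.le_rightOrthogonal _ Y.property).map_bijective_of_isTriangulated E.trW.Q X.obj).comp
      (P.fullyFaithfulι.map_bijective X Y)
  have : (P.ι ⋙ E.trW.Q).Full := ⟨fun {X Y} ↦ (bijective X Y).2⟩
  have : (P.ι ⋙ E.trW.Q).Faithful := ⟨fun {X Y} ↦ @(bijective X Y).1⟩
  exact triangleEquivalent_of_essImage_eq _ _ (h.essImage_verdierFunctor L₁)

end TriangleEquivalent

section NullHomotopic

open CochainComplex HomComplex Opposite

variable {C : Type*} [Category* C] [Preadditive C]

lemma exists_cochain_eqUpTo {K L : CochainComplex C ℤ} (f : K ⟶ L) (α : Cochain K L (-1))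
    (n m : ℤ) (hnm : n + 1 = m)
    (hK : ∀ (i k : ℤ), i + 1 = m → m + 1 = k → ∀ g : K.X m ⟶ L.X m, K.d i m ≫ g = 0 →
      ∃ g' : K.X k ⟶ L.X m, K.d m k ≫ g' = g)
    (hα : (δ (-1) 0 α).EqUpTo (Cochain.ofHom f) n) :
    ∃ (h : K.X (n + 2) ⟶ L.X (n + 1)),
      (δ (-1) 0 (α + Cochain.single h (-1))).EqUpTo (Cochain.ofHom f) m := by
  subst hnm
  let u := f.f (n + 1) - α.v (n + 1) n (by lia) ≫ L.d n (n + 1) -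
    K.d (n + 1) (n + 2) ≫ α.v (n + 2) (n + 1) (by lia)
  have d_comp_u : K.d n (n + 1) ≫ u = 0 := by
    have eq := hα n n (add_zero n) (by rfl)
    simp only [δ_v (-1) 0 (neg_add_cancel 1) α n n (add_zero _) (n - 1) (n + 1)
      (by lia) (by lia), Int.negOnePow_zero, one_smul, Cochain.ofHom_v] at eq
    simp only [u, Preadditive.comp_sub, HomologicalComplex.d_comp_d_assoc, zero_comp,
      ← f.comm, ← eq, Preadditive.add_comp, Category.assoc, L.d_comp_d, comp_zero, zero_add,
      sub_self]
  obtain ⟨β, hβ⟩ : ∃ (β : K.X (n + 2) ⟶ L.X (n + 1)), K.d (n + 1) (n + 2) ≫ β = u :=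
    hK n (n + 2) rfl (by lia) u d_comp_u
  refine ⟨β, fun p q hpq hp ↦ ?_⟩
  obtain rfl : p = q := by lia
  obtain hp | rfl := hp.lt_or_eq
  · rw [δ_add, Cochain.add_v, hα p p (by lia) (by lia), add_eq_left,
      δ_v (-1) 0 (neg_add_cancel 1) _ p p hpq (p - 1) (p + 1) rfl rfl,
      Cochain.single_v_eq_zero _ _ _ _ _ (by lia),
      Cochain.single_v_eq_zero _ _ _ _ _ (by lia)]
    simp
  · rw [δ_v (-1) 0 (neg_add_cancel 1) _ (n + 1) (n + 1) (by lia) n (n + 2)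
      (by lia) (by lia), Cochain.add_v,
      Cochain.single_v_eq_zero _ _ _ _ _ (by lia)]
    simp [hβ, u]

open Cochain.InductionUp in
lemma nonempty_homotopy_zero_of_isStrictlyGE {K L : CochainComplex C ℤ} (d : ℤ)
    [L.IsStrictlyGE d]
    (hK : ∀ (i j k : ℤ), i + 1 = j → j + 1 = k → ∀ g : K.X j ⟶ L.X j, K.d i j ≫ g = 0 →
      ∃ g' : K.X k ⟶ L.X j, K.d j k ≫ g' = g) (f : K ⟶ L) : Nonempty (Homotopy f 0) := by
  let X (n : ℕ) : Set (Cochain K L (-1)) :=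
    Set.ofPred (fun α ↦ (δ (-1) 0 α).EqUpTo (Cochain.ofHom f) (n + d - 1))
  let x₀ : X 0 := ⟨0, fun p q hpq hp ↦
    IsZero.eq_of_tgt (L.isZero_of_isStrictlyGE d _ (by lia)) _ _⟩
  let φ (n : ℕ) (α : X n) : X (n + 1) :=
    ⟨_, (exists_cochain_eqUpTo f α.1 (n + d - 1) ((n + 1 : ℕ) + d - 1)
      (by lia) (fun i k ↦ hK i _ k) α.2).choose_spec⟩
  have hφ (k : ℕ) (x : X k) : (φ k x).1.EqUpTo x.1 (d + k) := fun p q hpq hp ↦ by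
    dsimp [φ]
    rw [add_eq_left, Cochain.single_v_eq_zero _ _ _ _ _ (by lia)]
  refine ⟨(Cochain.equivHomotopy f 0).symm ⟨limitSequence φ hφ x₀, ?_⟩⟩
  rw [Cochain.ofHom_zero, add_zero]
  ext n
  let k₀ := (n - d + 1).toNat
  rw [← (sequence φ x₀ k₀).2 n n (add_zero n) (by lia),
    δ_v (-1) 0 (neg_add_cancel 1) _ n n (by lia) (n - 1) (n + 1) rfl (by lia),
    δ_v (-1) 0 (neg_add_cancel 1) _ n n (by lia) (n - 1) (n + 1) rfl (by lia),
    limitSequence_eqUpTo φ hφ x₀ k₀ n (n - 1) (by lia) (by lia),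
    limitSequence_eqUpTo φ hφ x₀ k₀ (n + 1) n (by lia) (by lia)]

lemma nonempty_homotopy_zero_of_isStrictlyLE {K L : CochainComplex C ℤ} (d : ℤ)
    [K.IsStrictlyLE d]
    (hL : ∀ (i j k : ℤ), i + 1 = j → j + 1 = k → ∀ g : K.X j ⟶ L.X j, g ≫ L.d j k = 0 →
      ∃ g' : K.X j ⟶ L.X i, g' ≫ L.d i j = g) (f : K ⟶ L) : Nonempty (Homotopy f 0) := by
  have : ((opEquivalence C).functor.obj (op K)).IsStrictlyGE (-d) := by
    rw [isStrictlyGE_iff]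
    intro i hi
    exact (K.isZero_of_isStrictlyLE d (-i) (by lia)).op
  obtain ⟨h⟩ := nonempty_homotopy_zero_of_isStrictlyGE (-d) (fun i j k hi hk g hg ↦ by
    obtain ⟨g', hg'⟩ := hL (-k) (-j) (-i) (by lia) (by lia) g.unop (Quiver.Hom.op_inj hg)
    exact ⟨g'.op, Quiver.Hom.unop_inj hg'⟩) ((opEquivalence C).functor.map f.op)
  exact ⟨homotopyUnop (h.trans (.ofEq (by simp)))⟩

end NullHomotopic

section Orthogonal

variable {R : Type u} [Ring R]

lemma IsPureEpi.epi {A B : ModuleCat.{u} R} {p : A ⟶ B} (hp : IsPureEpi p) : Epi p := by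
  obtain ⟨_, _, _, h⟩ := hp
  exact h.shortExact.epi_g

lemma IsPureProjective.exists_lift {P A B : ModuleCat.{u} R} (hP : IsPureProjective P)
    {p : A ⟶ B} (hp : IsPureEpi p) (g : P ⟶ B) : ∃ g' : P ⟶ A, g' ≫ p = g := by
  obtain ⟨_, _, _, h⟩ := hp
  exact hP _ h g

lemma IsPureInjective.exists_extension {I A B : ModuleCat.{u} R} (hI : IsPureInjective I)
    {i : A ⟶ B} (hi : IsPureMono i) (g : A ⟶ I) : ∃ g' : B ⟶ I, i ≫ g' = g := by
  obtain ⟨_, _, _, h⟩ := hi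
  exact hI _ h g

variable {X : CochainComplex (ModuleCat.{u} R) ℤ}

lemma IsPureProjective.exists_comp_d_eq {P : ModuleCat.{u} R} (hP : IsPureProjective P)
    (hX : ∀ n, TensorExactAt X n) {i j k : ℤ} (hi : i + 1 = j) (hk : j + 1 = k)
    (g : P ⟶ X.X j) (hg : g ≫ X.d j k = 0) : ∃ g' : P ⟶ X.X i, g' ≫ X.d i j = g := by
  obtain ⟨g', hg'⟩ := hP.exists_lift
    (isPureEpi_lift (i := i - 1) (by lia) hi hk (hX _) (hX _) (hX _)) (kernel.lift _ g hg)
  refine ⟨g', ?_⟩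
  simpa only [Category.assoc, kernel.lift_ι] using hg' =≫ kernel.ι _

/-- `d j k` is the epimorphism `p` onto its image followed by a pure monomorphism. -/
lemma IsPureInjective.exists_d_comp_eq {I : ModuleCat.{u} R} (hI : IsPureInjective I)
    (hX : ∀ n, TensorExactAt X n) {i j k : ℤ} (hi : i + 1 = j) (hk : j + 1 = k)
    (g : X.X j ⟶ I) (hg : X.d i j ≫ g = 0) : ∃ g' : X.X k ⟶ I, X.d j k ≫ g' = g := by
  let p := kernel.lift (X.d k (k + 1)) (X.d j k) (X.d_comp_d _ _ _)
  have p_comp_ι : p ≫ kernel.ι (X.d k (k + 1)) = X.d j k := kernel.lift_ι _ _ _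
  have d_comp_p : X.d i j ≫ p = 0 := by
    rw [← cancel_mono (kernel.ι _), Category.assoc, p_comp_ι, X.d_comp_d, zero_comp]
  have : Epi p := (isPureEpi_lift hi hk rfl (hX _) (hX _) (hX _)).epi
  have exact : (ShortComplex.mk _ _ d_comp_p).Exact :=
    (ShortComplex.moduleCat_exact_iff _).2 fun y hy ↦ (hX j).exact i k hi hk y (by
      rw [← p_comp_ι]
      exact (congrArg (kernel.ι (X.d k (k + 1))) hy).trans (map_zero _))
  obtain ⟨g', hg'⟩ := hI.exists_extension (isPureMono_kernel (k := k + 1) hk rfl (hX j) (hX k))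
    (exact.desc g hg)
  exact ⟨g', by rw [← p_comp_ι, Category.assoc, hg']; exact exact.g_desc g hg⟩

variable (R)

lemma minusPP_le_leftOrthogonal : minusPP R ≤ (pureExact R).leftOrthogonal := by
  rintro X ⟨⟨n, _⟩, hX⟩ Y f hY
  obtain ⟨f : X.as ⟶ Y.as, rfl⟩ := (HomotopyCategory.quotient _ _).map_surjective f
  rw [pureExact_iff] at hY
  obtain ⟨h⟩ := nonempty_homotopy_zero_of_isStrictlyLE n
    (fun i j k hi hk g hg ↦ (hX j).exists_comp_d_eq hY hi hk g hg) f
  exact (HomotopyCategory.eq_of_homotopy _ _ h).trans (Functor.map_zero _ _ _)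

lemma plusPI_le_rightOrthogonal : plusPI R ≤ (pureExact R).rightOrthogonal := by
  rintro X ⟨⟨n, _⟩, hX⟩ Y f hY
  obtain ⟨f : Y.as ⟶ X.as, rfl⟩ := (HomotopyCategory.quotient _ _).map_surjective f
  rw [pureExact_iff] at hY
  obtain ⟨h⟩ := nonempty_homotopy_zero_of_isStrictlyGE n
    (fun i j k hi hk g hg ↦ (hX j).exists_d_comp_eq hY hi hk g hg) f
  exact (HomotopyCategory.eq_of_homotopy _ _ h).trans (Functor.map_zero _ _ _)

end Orthogonal

section Truncation

section Embedding

variable {ι ι' : Type*} {c : ComplexShape ι} {c' : ComplexShape ι'} {C : Type*} [Category* C]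
  [HasZeroMorphisms C] [HasZeroObject C] (K : HomologicalComplex C c') (e : c.Embedding c')
  [e.IsTruncGE] [∀ i', K.HasHomology i']

lemma isIso_embedding_πTruncGE_f {i : ι} {i' : ι'} (hi : e.f i = i') (h : ¬ e.BoundaryGE i) :
    IsIso ((K.πTruncGE e).f i') :=
  (e.isIso_liftExtend_f_iff (K.restrictionToTruncGE' e) (K.restrictionToTruncGE'_hasLift e) hi).2
    (K.isIso_restrictionToTruncGE' e i h)

end Embedding

section CochainComplex

variable {C : Type*} [Category* C] [Abelian C] (X : CochainComplex C ℤ) {m i : ℤ}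

lemma isIso_πTruncGE_f (hi : m < i) : IsIso ((X.πTruncGE m).f i) := by
  have hi' : (ComplexShape.embeddingUpIntGE m).f (i - m).toNat = i := by
    rw [ComplexShape.embeddingUpIntGE_f]
    lia
  refine isIso_embedding_πTruncGE_f X _ hi' fun h ↦ ?_
  rw [ComplexShape.boundaryGE_embeddingUpIntGE_iff] at h
  lia

lemma isIso_ιTruncLE_f (hi : i < m) : IsIso ((X.ιTruncLE m).f i) := by
  have hi' : (ComplexShape.embeddingUpIntLE m).op.f (m - i).toNat = i := by
    change m - ((m - i).toNat : ℤ) = i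
    lia
  have : IsIso ((X.op.πTruncGE (ComplexShape.embeddingUpIntLE m).op).f i) := by
    refine isIso_embedding_πTruncGE_f X.op _ hi' fun h ↦ ?_
    rw [ComplexShape.Embedding.op_boundaryGE_iff,
      ComplexShape.boundaryLE_embeddingUpIntLE_iff] at h
    lia
  exact inferInstanceAs (IsIso ((X.op.πTruncGE (ComplexShape.embeddingUpIntLE m).op).f i).unop)

lemma exactAt_truncLE (hX : X.ExactAt m) : (X.truncLE m).ExactAt m := by
  rw [← quasiIsoAt_iff_exactAt' (X.ιTruncLE m) m hX]
  infer_instance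

end CochainComplex

variable {R : Type u} [Ring R] {X Y : CochainComplex (ModuleCat.{u} R) ℤ}

lemma tensorFunctor_map_f_d (f : X ⟶ Y) (M : ModuleCat.{u} Rᵐᵒᵖ) (i j : ℤ)
    (x : (tensorFunctor M).obj (X.X i)) :
    (tensorFunctor M).map (f.f j) ((tensorFunctor M).map (X.d i j) x) =
      (tensorFunctor M).map (Y.d i j) ((tensorFunctor M).map (f.f i) x) := by
  simp only [← ConcreteCategory.comp_apply, ← Functor.map_comp, f.comm]

lemma tensorExactAt_of_isZero_X {n : ℤ} (h : IsZero (X.X n)) : TensorExactAt X n := fun M ↦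
  ShortComplex.exact_of_isZero_X₂ _ ((tensorFunctor M).map_isZero h)

lemma tensorExactAt_of_surjective_d {i j : ℤ} (hij : i + 1 = j)
    (h : Function.Surjective (X.d i j)) : TensorExactAt X j := by
  rw [tensorExactAt_iff X i j (j + 1) hij rfl]
  exact fun M y _ ↦ tensorFunctor_map_surjective M _ h y

lemma TensorExactAt.exactAt {n : ℤ} (h : TensorExactAt X n) : X.ExactAt n := by
  rw [HomologicalComplex.exactAt_iff' _ (n - 1) n (n + 1) (by simp) (by simp),
    ShortComplex.moduleCat_exact_iff]
  exact h.exact (n - 1) (n + 1) (by lia) rfl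

lemma TensorExactAt.of_surjective {n : ℤ} (hX : TensorExactAt X n) (f : X ⟶ Y)
    (hf : Function.Surjective (f.f n))
    (hf' : ∀ M, Function.Injective ((tensorFunctor M).map (f.f (n + 1)))) : TensorExactAt Y n := by
  rw [tensorExactAt_iff _ (n - 1) n (n + 1) (by lia) rfl] at hX ⊢
  intro M y hy
  obtain ⟨y, rfl⟩ := tensorFunctor_map_surjective M _ hf y
  rw [← tensorFunctor_map_f_d] at hy
  obtain ⟨x, rfl⟩ := hX M y (hf' M (hy.trans (map_zero _).symm))
  exact ⟨(tensorFunctor M).map (f.f (n - 1)) x, (tensorFunctor_map_f_d ..).symm⟩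

lemma tensorFunctor_map_f_injective (f : X ⟶ Y) {i j k : ℤ} (hi : i + 1 = j) (hk : j + 1 = k)
    [IsIso (f.f i)] [IsIso (f.f j)] (hX : Function.Surjective (X.d j k)) (hY : TensorExactAt Y j)
    (M : ModuleCat.{u} Rᵐᵒᵖ) : Function.Injective ((tensorFunctor M).map (f.f k)) := by
  rw [injective_iff_map_eq_zero]
  intro z hz
  obtain ⟨y, rfl⟩ := tensorFunctor_map_surjective M _ hX z
  rw [tensorFunctor_map_f_d] at hz
  obtain ⟨x', hx'⟩ := (tensorExactAt_iff Y i j k hi hk).1 hY M _ hz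
  obtain ⟨x, rfl⟩ := (ConcreteCategory.bijective_of_isIso ((tensorFunctor M).map (f.f i))).2 x'
  rw [← tensorFunctor_map_f_d] at hx'
  rw [← (ConcreteCategory.bijective_of_isIso ((tensorFunctor M).map (f.f j))).1 hx',
    ← ConcreteCategory.comp_apply, ← Functor.map_comp, X.d_comp_d, Functor.map_zero]
  rfl

lemma trW_quotient_map (f : X ⟶ Y)
    (hf : ∀ M, QuasiIso (((tensorFunctor M).mapHomologicalComplex _).map f)) :
    (pureExact R).trW ((HomotopyCategory.quotient _ _).map f) := by
  refine .mk _ (HomotopyCategory.mappingCone_triangleh_distinguished f) ?_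
  rw [pureExact_iff]
  intro n M
  let φ := ((tensorFunctor M).mapHomologicalComplex _).map f
  have exactAt : (CochainComplex.mappingCone φ).ExactAt n := by
    refine (HomotopyCategory.quotient_obj_mem_subcategoryAcyclic_iff_exactAt _).1
      (((HomotopyCategory.subcategoryAcyclic _).trW_iff_of_distinguished _
        (HomotopyCategory.mappingCone_triangleh_distinguished φ)).1 ?_) n
    rw [← HomotopyCategory.quasiIso_eq_trW_subcategoryAcyclic]
    exact (HomotopyCategory.quotient_map_mem_quasiIso_iff φ).2 (hf M)
  exact exactAt.of_iso (CochainComplex.mappingCone.mapHomologicalComplexIso f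
    (tensorFunctor M)).symm

lemma quasiIso_tensor_map (f : X ⟶ Y) (hf : ∀ i, TensorExactAt X i ∧ TensorExactAt Y i ∨
      Function.Surjective (f.f (i - 1)) ∧ IsIso (f.f i) ∧
        ∀ M, Function.Injective ((tensorFunctor M).map (f.f (i + 1))))
    (M : ModuleCat.{u} Rᵐᵒᵖ) : QuasiIso (((tensorFunctor M).mapHomologicalComplex _).map f) where
  quasiIsoAt i := by
    obtain ⟨hX, hY⟩ | ⟨surjective, _, injective⟩ := hf i
    · rw [quasiIsoAt_iff_exactAt _ _ (hX M)]
      exact hY M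
    · rw [quasiIsoAt_iff' _ (i - 1) i (i + 1) (by simp) (by simp)]
      let φ := (HomologicalComplex.shortComplexFunctor' _ _ (i - 1) i (i + 1)).map
        (((tensorFunctor M).mapHomologicalComplex (.up ℤ)).map f)
      have : Epi φ.τ₁ := (AddCommGrpCat.epi_iff_surjective _).2
        (tensorFunctor_map_surjective M _ surjective)
      have : IsIso φ.τ₂ := inferInstanceAs (IsIso ((tensorFunctor M).map (f.f i)))
      have : Mono φ.τ₃ := (AddCommGrpCat.mono_iff_injective _).2 (injective M)
      exact ShortComplex.quasiIso_of_epi_of_isIso_of_mono φ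

lemma trW_πTruncGE {m : ℤ} (hX : ∀ i ≤ m, TensorExactAt X i) :
    (pureExact R).trW ((HomotopyCategory.quotient _ _).map (X.πTruncGE m)) := by
  have surjective (i : ℤ) : Function.Surjective ((X.πTruncGE m).f i) :=
    (ModuleCat.epi_iff_surjective _).1 (by dsimp [CochainComplex.πTruncGE]; infer_instance)
  have injective (i : ℤ) (hi : m < i) (M) :
      Function.Injective ((tensorFunctor M).map ((X.πTruncGE m).f i)) :=
    have := isIso_πTruncGE_f X hi
    (ConcreteCategory.bijective_of_isIso ((tensorFunctor M).map ((X.πTruncGE m).f i))).1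
  refine trW_quotient_map _ (quasiIso_tensor_map _ fun i ↦ ?_)
  obtain hi | rfl | hi := lt_trichotomy i m
  · exact .inl ⟨hX i hi.le,
      tensorExactAt_of_isZero_X (CochainComplex.isZero_of_isStrictlyGE _ m i hi)⟩
  · exact .inl ⟨hX i le_rfl,
      (hX i le_rfl).of_surjective _ (surjective i) (injective (i + 1) (by lia))⟩
  · exact .inr ⟨surjective _, isIso_πTruncGE_f X hi, injective (i + 1) (by lia)⟩

lemma surjective_truncLE_d {m : ℤ} (hX : X.ExactAt m) :
    Function.Surjective ((X.truncLE m).d (m - 1) m) := by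
  have h := exactAt_truncLE X hX
  rw [HomologicalComplex.exactAt_iff' _ (m - 1) m (m + 1) (by simp) (by simp),
    ShortComplex.moduleCat_exact_iff] at h
  have d_eq_zero : (X.truncLE m).d m (m + 1) = 0 :=
    (CochainComplex.isZero_of_isStrictlyLE _ m (m + 1) (by lia)).eq_of_tgt _ _
  exact fun y ↦ h y (ConcreteCategory.congr_hom d_eq_zero y)

lemma trW_ιTruncLE {m : ℤ} (hX : ∀ i ≥ m - 1, TensorExactAt X i) :
    (pureExact R).trW ((HomotopyCategory.quotient _ _).map (X.ιTruncLE m)) := by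
  have bijective (i : ℤ) (hi : i < m) : Function.Bijective ((X.ιTruncLE m).f i) :=
    have := isIso_ιTruncLE_f X hi
    ConcreteCategory.bijective_of_isIso ((X.ιTruncLE m).f i)
  have surjective_d := surjective_truncLE_d (hX m (by lia)).exactAt
  have injective (i : ℤ) (hi : i ≤ m) (M) :
      Function.Injective ((tensorFunctor M).map ((X.ιTruncLE m).f i)) := by
    obtain hi | rfl := hi.lt_or_eq
    · have := isIso_ιTruncLE_f X hi
      exact (ConcreteCategory.bijective_of_isIso ((tensorFunctor M).map ((X.ιTruncLE m).f i))).1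
    · have := isIso_ιTruncLE_f X (m := i) (i := i - 1 - 1) (by lia)
      have := isIso_ιTruncLE_f X (m := i) (i := i - 1) (by lia)
      exact tensorFunctor_map_f_injective _ (i := i - 1 - 1) (by lia) (by lia) surjective_d
        (hX (i - 1) le_rfl) M
  refine trW_quotient_map _ (quasiIso_tensor_map _ fun i ↦ ?_)
  obtain hi | rfl | hi := lt_trichotomy i m
  · exact .inr ⟨(bijective _ (by lia)).2, isIso_ιTruncLE_f X hi, injective (i + 1) (by lia)⟩
  · exact .inl ⟨tensorExactAt_of_surjective_d (by lia) surjective_d, hX i (by lia)⟩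
  · exact .inl ⟨tensorExactAt_of_isZero_X (CochainComplex.isZero_of_isStrictlyLE _ m i hi),
      hX i (by lia)⟩

lemma exists_fac_truncGE {Q Y : K R} (f : Q ⟶ Y) (hQ : minusPP R Q) (hQ' : infPurFinite R Q)
    (hY : bounded R Y) : ∃ (Z : K R) (s : Q ⟶ Z) (g : Z ⟶ Y),
      bounded R Z ∧ (pureExact R).trW s ∧ s ≫ g = f := by
  obtain ⟨⟨n, _⟩, -⟩ := hQ
  obtain ⟨c, hc⟩ := (infPurFinite_iff Q).1 hQ'
  obtain ⟨a, _, _, _⟩ := hY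
  obtain ⟨f : Q.as ⟶ Y.as, rfl⟩ := (HomotopyCategory.quotient _ _).map_surjective f
  let m := min a (c - 1)
  have := CochainComplex.isStrictlyGE_of_ge Y.as m a (by lia)
  refine ⟨(HomotopyCategory.quotient _ _).obj (CochainComplex.truncGE Q.as m),
    (HomotopyCategory.quotient _ _).map (CochainComplex.πTruncGE Q.as m),
    (HomotopyCategory.quotient _ _).map
      (CochainComplex.truncGEMap f m ≫ inv (CochainComplex.πTruncGE Y.as m)),
    ⟨m, n, inferInstanceAs ((CochainComplex.truncGE Q.as m).IsStrictlyGE m),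
      inferInstanceAs ((CochainComplex.truncGE Q.as m).IsStrictlyLE n)⟩,
    trW_πTruncGE fun i hi ↦ hc i (by lia), ?_⟩
  exact (Functor.map_comp _ _ _).symm.trans (congrArg _ (by simp))

lemma exists_fac_truncLE {Y Q : K R} (f : Y ⟶ Q) (hY : bounded R Y) (hQ : plusPI R Q)
    (hQ' : supPurFinite R Q) : ∃ (Z : K R) (g : Y ⟶ Z) (s : Z ⟶ Q),
      bounded R Z ∧ (pureExact R).trW s ∧ g ≫ s = f := by
  obtain ⟨⟨n, _⟩, -⟩ := hQ
  obtain ⟨c, hc⟩ := (supPurFinite_iff Q).1 hQ'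
  obtain ⟨_, b, _, _⟩ := hY
  obtain ⟨f : Y.as ⟶ Q.as, rfl⟩ := (HomotopyCategory.quotient _ _).map_surjective f
  let m := max b (c + 2)
  have := CochainComplex.isStrictlyLE_of_le Y.as b m (by lia)
  refine ⟨(HomotopyCategory.quotient _ _).obj (CochainComplex.truncLE Q.as m),
    (HomotopyCategory.quotient _ _).map
      (inv (CochainComplex.ιTruncLE Y.as m) ≫ CochainComplex.truncLEMap f m),
    (HomotopyCategory.quotient _ _).map (CochainComplex.ιTruncLE Q.as m),
    ⟨n, m, inferInstanceAs ((CochainComplex.truncLE Q.as m).IsStrictlyGE n),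
      inferInstanceAs ((CochainComplex.truncLE Q.as m).IsStrictlyLE m)⟩,
    trW_ιTruncLE fun i hi ↦ hc i (by lia), ?_⟩
  exact (Functor.map_comp _ _ _).symm.trans (congrArg _ (by simp))

end Truncation

section StupidTruncation

variable {C : Type*} [Category* C] [Abelian C]

lemma exists_distTriang_of_isSplitEpi_f {X B : CochainComplex C ℤ} (g : X ⟶ B)
    [∀ i, IsSplitEpi (g.f i)] :
    ∃ h, Triangle.mk ((HomotopyCategory.quotient C (.up ℤ)).map (kernel.ι g))
      ((HomotopyCategory.quotient C (.up ℤ)).map g) h ∈ distTriang _ := by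
  let S := ShortComplex.mk (kernel.ι g) g (kernel.condition g)
  let s (i : ℤ) : B.X i ⟶ X.X i := section_ (g.f i)
  let σ (i : ℤ) : (S.map (HomologicalComplex.eval C (.up ℤ) i)).Splitting :=
    .ofExactOfSection _ ((ShortComplex.exact_kernel g).map _) (s i) (IsSplitEpi.id (g.f i))
      (inferInstanceAs (Mono ((HomologicalComplex.eval C (.up ℤ) i).map (kernel.ι g))))
  exact ⟨(CochainComplex.trianglehOfDegreewiseSplit S σ).mor₃,
    (HomotopyCategory.distinguished_iff_iso_trianglehOfDegreewiseSplit _).2 ⟨S, σ, ⟨Iso.refl _⟩⟩⟩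

lemma isIso_kernel_ι_f {X B : CochainComplex C ℤ} (g : X ⟶ B) {i : ℤ} (hB : IsZero (B.X i)) :
    IsIso ((kernel.ι g).f i) :=
  have exact := (ShortComplex.exact_kernel g).map (HomologicalComplex.eval C (.up ℤ) i)
  have : Epi ((kernel.ι g).f i) := exact.epi_f (hB.eq_of_tgt _ _)
  isIso_of_mono_of_epi _

lemma isZero_kernel_X {X B : CochainComplex C ℤ} (g : X ⟶ B) (i : ℤ) [Mono (g.f i)] :
    IsZero ((kernel g).X i) := by
  refine IsZero.of_mono_eq_zero ((kernel.ι g).f i) ?_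
  rw [← cancel_mono (g.f i), zero_comp, ← HomologicalComplex.comp_f, kernel.condition,
    HomologicalComplex.zero_f]

lemma exists_stupidTruncLE (X : CochainComplex C ℤ) (n : ℤ) :
    ∃ (B : CochainComplex C ℤ) (g : X ⟶ B), B.IsStrictlyLE n ∧ ∀ i ≤ n, IsIso (g.f i) := by
  let e := ComplexShape.embeddingUpIntLE n
  refine ⟨X.stupidTrunc e,
    e.liftExtend (𝟙 (X.restriction e)) fun j hj ↦ hj.false_of_isTruncLE.elim,
    inferInstance, fun i hi ↦ ?_⟩
  have hi' : e.f (n - i).toNat = i := by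
    simp only [e, ComplexShape.embeddingUpIntLE_f]
    lia
  exact (e.isIso_liftExtend_f_iff (𝟙 (X.restriction e)) _ hi').2 (inferInstanceAs (IsIso (𝟙 _)))

lemma exists_stupidTrunc_triangle (X : CochainComplex C ℤ) (n : ℤ) :
    ∃ (A B : CochainComplex C ℤ) (f : A ⟶ X) (g : X ⟶ B)
      (h : (HomotopyCategory.quotient C (.up ℤ)).obj B ⟶
        ((HomotopyCategory.quotient C (.up ℤ)).obj A)⟦(1 : ℤ)⟧),
      Triangle.mk ((HomotopyCategory.quotient C (.up ℤ)).map f)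
        ((HomotopyCategory.quotient C (.up ℤ)).map g) h ∈
          distTriang (HomotopyCategory C (.up ℤ)) ∧
      A.IsStrictlyGE (n + 1) ∧ (∀ i > n, IsIso (f.f i)) ∧
      B.IsStrictlyLE n ∧ (∀ i ≤ n, IsIso (g.f i)) := by
  obtain ⟨B, g, hB, hg⟩ := exists_stupidTruncLE X n
  have isZero (i : ℤ) (hi : n < i) : IsZero (B.X i) := B.isZero_of_isStrictlyLE n i hi
  have isSplitEpi (i : ℤ) : IsSplitEpi (g.f i) := by
    obtain hi | hi := le_or_gt i n
    · have := hg i hi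
      infer_instance
    · exact ⟨⟨0, (isZero i hi).eq_of_src _ _⟩⟩
  obtain ⟨h, hT⟩ := exists_distTriang_of_isSplitEpi_f g
  refine ⟨kernel g, B, kernel.ι g, g, h, hT, ?_, fun i hi ↦ isIso_kernel_ι_f g (isZero i hi),
    hB, hg⟩
  refine (CochainComplex.isStrictlyGE_iff _ _).2 fun i hi ↦ ?_
  have := hg i (by lia)
  exact isZero_kernel_X g i

lemma nonempty_iso_singleFunctor_obj (X : CochainComplex C ℤ) (n : ℤ) [X.IsStrictlyGE n]
    [X.IsStrictlyLE n] {A : C} (e : X.X n ≅ A) :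
    Nonempty (X ≅ (CochainComplex.singleFunctor C n).obj A) := by
  obtain ⟨B, ⟨i⟩⟩ := X.exists_iso_single n
  exact ⟨i ≪≫ (CochainComplex.singleFunctor C n).mapIso
    ((HomologicalComplex.singleObjXSelf (.up ℤ) n B).symm ≪≫
      HomologicalComplex.Hom.isoApp i.symm n ≪≫ e)⟩

section Devissage

variable (P : ObjectProperty (HomotopyCategory C (.up ℤ))) [P.IsTriangulated]
  [P.IsClosedUnderIsomorphisms] {d : ℤ}
  (hP : ∀ A : C, P ((HomotopyCategory.quotient C (.up ℤ)).obj
    ((CochainComplex.singleFunctor C d).obj A)))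
include hP

lemma prop_of_isStrictlyGE_of_isStrictlyLE_self (X : CochainComplex C ℤ) (n : ℤ)
    [X.IsStrictlyGE n] [X.IsStrictlyLE n] : P ((HomotopyCategory.quotient C (.up ℤ)).obj X) := by
  have : (X⟦n - d⟧).IsStrictlyGE d := X.isStrictlyGE_shift n (n - d) d (by lia)
  have : (X⟦n - d⟧).IsStrictlyLE d := X.isStrictlyLE_shift n (n - d) d (by lia)
  obtain ⟨A, ⟨e⟩⟩ := (X⟦n - d⟧).exists_iso_single d
  rw [← P.prop_shift_iff_of_isStableUnderShift _ (n - d)]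
  exact P.prop_of_iso ((HomotopyCategory.quotient C (.up ℤ)).mapIso e.symm ≪≫
    ((HomotopyCategory.quotient C (.up ℤ)).commShiftIso (n - d)).app X) (hP A)

lemma prop_of_isStrictlyGE_of_isStrictlyLE (X : CochainComplex C ℤ) (a b : ℤ)
    [X.IsStrictlyGE a] [X.IsStrictlyLE b] : P ((HomotopyCategory.quotient C (.up ℤ)).obj X) := by
  suffices h : ∀ (k : ℕ) (X : CochainComplex C ℤ) [X.IsStrictlyGE a] [X.IsStrictlyLE (a + k)],
      P ((HomotopyCategory.quotient C (.up ℤ)).obj X) by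
    have := X.isStrictlyLE_of_le b (a + (b - a).toNat) (by lia)
    exact h (b - a).toNat X
  intro k
  induction k with
  | zero =>
    intro X _ _
    have : X.IsStrictlyLE a := X.isStrictlyLE_of_le (a + (0 : ℕ)) a (by lia)
    exact prop_of_isStrictlyGE_of_isStrictlyLE_self P hP X a
  | succ k ih =>
    intro X _ _
    obtain ⟨A, B, f, g, h, hT, _, hf, _, hg⟩ := exists_stupidTrunc_triangle X (a + k)
    have : A.IsStrictlyLE (a + k + 1) := (A.isStrictlyLE_iff _).2 fun i hi ↦
      have := hf i (by lia)
      (X.isZero_of_isStrictlyLE (a + (k + 1 : ℕ)) i (by lia)).of_iso (asIso (f.f i))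
    have : B.IsStrictlyGE a := (B.isStrictlyGE_iff _).2 fun i hi ↦
      have := hg i (by lia)
      (X.isZero_of_isStrictlyGE _ i hi).of_iso (asIso (g.f i)).symm
    exact P.ext_of_isTriangulatedClosed₂ _ hT
      (prop_of_isStrictlyGE_of_isStrictlyLE_self P hP A (a + k + 1)) (ih B)

end Devissage

end StupidTruncation

section Splicing

variable {C : Type*} [Category* C] [HasZeroMorphisms C] (T : ℤ → ShortComplex C)
  (e : ∀ n, (T n).X₃ ≅ (T (n + 1)).X₁)

/-- The differential `Xⁿ ⟶ Zⁿ⁺¹ ⟶ Xⁿ⁺¹` of the Yoneda splice of a sequence of short complexes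
`Zⁿ ⟶ Xⁿ ⟶ Zⁿ⁺¹`. -/
def spliceD (n : ℤ) : (T n).X₂ ⟶ (T (n + 1)).X₂ := (T n).g ≫ (e n).hom ≫ (T (n + 1)).f

lemma spliceD_comp_spliceD (n : ℤ) : spliceD T e n ≫ spliceD T e (n + 1) = 0 := by
  simp [spliceD]

/-- The Yoneda splice of a sequence of short complexes `Zⁿ ⟶ Xⁿ ⟶ Zⁿ⁺¹`. -/
def splice : CochainComplex C ℤ :=
  CochainComplex.of (fun n ↦ (T n).X₂) (spliceD T e) (spliceD_comp_spliceD T e)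

lemma splice_d (n : ℤ) : (splice T e).d n (n + 1) = spliceD T e n :=
  CochainComplex.of_d (fun n ↦ (T n).X₂) (spliceD T e) n

end Splicing

section Resolutions

variable {R : Type u} [Ring R]

lemma isPureExact_of_splitting {S : ShortComplex (ModuleCat.{u} R)} (s : S.Splitting) :
    IsPureExact S where
  shortExact := s.shortExact
  tensor M := (s.map (tensorFunctor M)).shortExact

lemma tensorExactAt_splice (T : ℤ → ShortComplex (ModuleCat.{u} R))
    (e : ∀ n, (T n).X₃ ≅ (T (n + 1)).X₁) (hT : ∀ n, IsPureExact (T n)) (n : ℤ) :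
    TensorExactAt (splice T e) n := by
  obtain ⟨n, rfl⟩ : ∃ m, n = m + 1 := ⟨n - 1, by lia⟩
  rw [tensorExactAt_iff _ n (n + 1) (n + 1 + 1) rfl rfl, splice_d, splice_d]
  intro M (y : (tensorFunctor M).obj (T (n + 1)).X₂) hy
  have map_spliceD (n : ℤ) (x : (tensorFunctor M).obj (T n).X₂) :
      (tensorFunctor M).map (spliceD T e n) x = (tensorFunctor M).map ((e n).hom ≫ (T (n + 1)).f)
        ((tensorFunctor M).map (T n).g x) := by
    rw [spliceD, Functor.map_comp, ConcreteCategory.comp_apply]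
  have injective (n : ℤ) :
      Function.Injective ((tensorFunctor M).map ((e n).hom ≫ (T (n + 1)).f)) := by
    have : Mono ((tensorFunctor M).map (T (n + 1)).f) := ((hT (n + 1)).tensor M).mono_f
    rw [← AddCommGrpCat.mono_iff_injective, Functor.map_comp]
    infer_instance
  have exact_tensor := (ShortComplex.ab_exact_iff _).1 ((hT (n + 1)).tensor M).exact
  obtain ⟨z, rfl⟩ := exact_tensor y
    (injective (n + 1) ((map_spliceD (n + 1) y).symm.trans (hy.trans (map_zero _).symm)))
  obtain ⟨z, rfl⟩ := (ConcreteCategory.bijective_of_isIso ((tensorFunctor M).map (e n).hom)).2 z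
  obtain ⟨x, rfl⟩ := tensorFunctor_map_surjective M _ (hT n).shortExact.moduleCat_surjective_g z
  refine ⟨x, (map_spliceD n x).trans ?_⟩
  rw [Functor.map_comp, ConcreteCategory.comp_apply]
  rfl

lemma exists_pureProjectiveResolution (A : ModuleCat.{u} R) :
    ∃ X : CochainComplex (ModuleCat.{u} R) ℤ, (∀ n, TensorExactAt X n) ∧ Nonempty (X.X 0 ≅ A) ∧
      X.IsStrictlyLE 0 ∧ ∀ n < 0, IsPureProjective (X.X n) := by
  choose P π hP ker ι w h using exists_isPureEpi (R := R)
  let syzygy (n : ℕ) : ModuleCat.{u} R := n.rec A fun _ ↦ ker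
  let identity (B : ModuleCat.{u} R) : ShortComplex (ModuleCat.{u} R) :=
    ⟨𝟙 B, (0 : B ⟶ 0), comp_zero⟩
  have isPureExact_identity (B) : IsPureExact (identity B) :=
    isPureExact_of_splitting (.ofIsIsoOfIsZero _ (inferInstanceAs (IsIso (𝟙 B))) (isZero_zero _))
  let T : ℤ → ShortComplex (ModuleCat.{u} R)
    | .ofNat 0 => identity A
    | .ofNat (_ + 1) => identity 0
    | .negSucc n => ⟨ι (syzygy n), π (syzygy n), w _⟩
  let e : ∀ n, (T n).X₃ ≅ (T (n + 1)).X₁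
    | .ofNat 0 => Iso.refl 0
    | .ofNat (_ + 1) => Iso.refl 0
    | .negSucc 0 => Iso.refl A
    | .negSucc (n + 1) => Iso.refl (syzygy (n + 1))
  have hT : ∀ n, IsPureExact (T n)
    | .ofNat 0 => isPureExact_identity A
    | .ofNat (_ + 1) => isPureExact_identity 0
    | .negSucc n => h (syzygy n)
  refine ⟨splice T e, tensorExactAt_splice T e hT, ⟨Iso.refl A⟩, ?_, ?_⟩
  · refine (CochainComplex.isStrictlyLE_iff _ _).2 fun n hn ↦ ?_
    obtain ⟨n, rfl⟩ : ∃ k : ℕ, n = .ofNat (k + 1) := ⟨(n - 1).toNat, by simp; lia⟩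
    exact isZero_zero _
  · intro n hn
    obtain ⟨n, rfl⟩ := Int.eq_negSucc_of_lt_zero hn
    exact hP (syzygy n)

lemma exists_pureInjectiveResolution (A : ModuleCat.{u} R) :
    ∃ X : CochainComplex (ModuleCat.{u} R) ℤ, (∀ n, TensorExactAt X n) ∧ Nonempty (X.X (-1) ≅ A) ∧
      X.IsStrictlyGE (-1) ∧ ∀ n ≥ 0, IsPureInjective (X.X n) := by
  choose I ι hI coker π w h using exists_isPureMono (R := R)
  let cosyzygy (n : ℕ) : ModuleCat.{u} R := n.rec A fun _ ↦ coker
  let identity (B : ModuleCat.{u} R) : ShortComplex (ModuleCat.{u} R) :=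
    ⟨(0 : 0 ⟶ B), 𝟙 B, zero_comp⟩
  have isPureExact_identity (B) : IsPureExact (identity B) :=
    isPureExact_of_splitting (.ofIsZeroOfIsIso _ (isZero_zero _) (inferInstanceAs (IsIso (𝟙 B))))
  let T : ℤ → ShortComplex (ModuleCat.{u} R)
    | .ofNat n => ⟨ι (cosyzygy n), π (cosyzygy n), w _⟩
    | .negSucc 0 => identity A
    | .negSucc (_ + 1) => identity 0
  let e : ∀ n, (T n).X₃ ≅ (T (n + 1)).X₁
    | .ofNat n => Iso.refl (cosyzygy (n + 1))
    | .negSucc 0 => Iso.refl A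
    | .negSucc 1 => Iso.refl 0
    | .negSucc (_ + 2) => Iso.refl 0
  have hT : ∀ n, IsPureExact (T n)
    | .ofNat n => h (cosyzygy n)
    | .negSucc 0 => isPureExact_identity A
    | .negSucc (_ + 1) => isPureExact_identity 0
  refine ⟨splice T e, tensorExactAt_splice T e hT, ⟨Iso.refl A⟩, ?_, ?_⟩
  · refine (CochainComplex.isStrictlyGE_iff _ _).2 fun n hn ↦ ?_
    obtain ⟨n, rfl⟩ : ∃ k : ℕ, n = .negSucc (k + 1) := ⟨(-n - 2).toNat, by lia⟩
    exact isZero_zero _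
  · intro n hn
    obtain ⟨n, rfl⟩ := Int.eq_ofNat_of_zero_le hn
    exact hI (cosyzygy n)

lemma trW_mor₃ {T : Triangle (K R)} (hT : T ∈ distTriang _) (h : pureExact R T.obj₂) :
    (pureExact R).trW T.mor₃ :=
  .mk _ (rot_of_distTriang _ (rot_of_distTriang _ hT)) ((pureExact R).le_shift (1 : ℤ) _ h)

lemma leftResolved_minusPP_single (A : ModuleCat.{u} R) :
    leftResolved (pureExact R) (minusPP R) ((HomotopyCategory.quotient _ _).obj
      ((CochainComplex.singleFunctor (ModuleCat.{u} R) 0).obj A)) := by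
  have := isTriangulated_leftResolved (minusPP_le_leftOrthogonal R)
  obtain ⟨X, exact, ⟨e⟩, _, hX⟩ := exists_pureProjectiveResolution A
  obtain ⟨Y, P, f, g, h, hT, _, hf, _, hg⟩ := exists_stupidTrunc_triangle X (-1)
  have : Y.IsStrictlyLE 0 := (Y.isStrictlyLE_iff 0).2 fun i hi ↦
    have := hf i (by lia)
    (X.isZero_of_isStrictlyLE 0 i hi).of_iso (asIso (f.f i))
  have : Y.IsStrictlyGE 0 := Y.isStrictlyGE_of_ge 0 (-1 + 1) (by lia)
  have := hf 0 (by lia)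
  obtain ⟨e'⟩ := nonempty_iso_singleFunctor_obj Y 0 (asIso (f.f 0) ≪≫ e)
  have minusPP_P : minusPP R ((HomotopyCategory.quotient _ _).obj P) := by
    refine ⟨⟨-1, ‹_›⟩, fun i ↦ ?_⟩
    obtain hi | hi := le_or_gt i (-1)
    · have := hg i hi
      have gᵢ := asIso (g.f i)
      exact (hX i (by lia)).of_iso gᵢ
    · exact isPureProjective_of_isZero (P.isZero_of_isStrictlyLE (-1) i hi)
  refine ObjectProperty.prop_of_iso _ ((HomotopyCategory.quotient _ _).mapIso e') ?_
  rw [← (leftResolved (pureExact R) (minusPP R)).prop_shift_iff_of_isStableUnderShift _ (1 : ℤ)]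
  exact ⟨_, h, minusPP_P, trW_mor₃ hT ((pureExact_iff _).2 exact)⟩

lemma rightResolved_plusPI_single (A : ModuleCat.{u} R) :
    rightResolved (pureExact R) (plusPI R) ((HomotopyCategory.quotient _ _).obj
      ((CochainComplex.singleFunctor (ModuleCat.{u} R) (-1)).obj A)) := by
  obtain ⟨X, exact, ⟨e⟩, _, hX⟩ := exists_pureInjectiveResolution A
  obtain ⟨I, Y, f, g, h, hT, _, hf, _, hg⟩ := exists_stupidTrunc_triangle X (-1)
  have : Y.IsStrictlyGE (-1) := (Y.isStrictlyGE_iff (-1)).2 fun i hi ↦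
    have := hg i (by lia)
    (X.isZero_of_isStrictlyGE (-1) i hi).of_iso (asIso (g.f i)).symm
  have := hg (-1) le_rfl
  obtain ⟨e'⟩ := nonempty_iso_singleFunctor_obj Y (-1) ((asIso (g.f (-1))).symm ≪≫ e)
  have plusPI_I : plusPI R ((HomotopyCategory.quotient _ _).obj I) := by
    refine ⟨⟨-1 + 1, ‹_›⟩, fun i ↦ ?_⟩
    obtain hi | hi := le_or_gt i (-1)
    · exact isPureInjective_of_isZero (I.isZero_of_isStrictlyGE (-1 + 1) i (by lia))
    · have := hf i hi
      exact (hX i (by lia)).of_iso (asIso (f.f i)).symm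
  refine ObjectProperty.prop_of_iso _ ((HomotopyCategory.quotient _ _).mapIso e') ?_
  exact ⟨_, h, (plusPI R).le_shift (1 : ℤ) _ plusPI_I, trW_mor₃ hT ((pureExact_iff _).2 exact)⟩

variable (R)

lemma bounded_le_leftResolved_minusPP : bounded R ≤ leftResolved (pureExact R) (minusPP R) := by
  rintro X ⟨a, b, _, _⟩
  have := isTriangulated_leftResolved (minusPP_le_leftOrthogonal R)
  exact prop_of_isStrictlyGE_of_isStrictlyLE _ leftResolved_minusPP_single X.as a b

lemma bounded_le_rightResolved_plusPI : bounded R ≤ rightResolved (pureExact R) (plusPI R) := by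
  rintro X ⟨a, b, _, _⟩
  have := isTriangulated_rightResolved (plusPI_le_rightOrthogonal R)
  exact prop_of_isStrictlyGE_of_isStrictlyLE _ rightResolved_plusPI_single X.as a b

lemma bounded_le_infPurFinite : bounded R ≤ infPurFinite R := by
  rintro X ⟨a, _, _, _⟩
  exact (infPurFinite_iff X).2 ⟨a, fun i hi ↦
    tensorExactAt_of_isZero_X (CochainComplex.isZero_of_isStrictlyGE X.as a i hi)⟩

lemma bounded_le_supPurFinite : bounded R ≤ supPurFinite R := by
  rintro X ⟨_, b, _, _⟩
  exact (supPurFinite_iff X).2 ⟨b, fun i hi ↦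
    tensorExactAt_of_isZero_X (CochainComplex.isZero_of_isStrictlyLE X.as b i hi)⟩

lemma pureExact_le_infPurFinite : pureExact R ≤ infPurFinite R := fun X hX ↦
  (infPurFinite_iff X).2 ⟨0, fun i _ ↦ (pureExact_iff X).1 hX i⟩

lemma pureExact_le_supPurFinite : pureExact R ≤ supPurFinite R := fun X hX ↦
  (supPurFinite_iff X).2 ⟨0, fun i _ ↦ (pureExact_iff X).1 hX i⟩

variable {R}

lemma infPurFinite_of_trW {X Y : K R} {s : X ⟶ Y} (hs : (pureExact R).trW s)
    (hY : infPurFinite R Y) : infPurFinite R X := by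
  obtain ⟨Z, _, _, hT, hZ⟩ := hs
  exact (infPurFinite R).ext_of_isTriangulatedClosed₁ _ hT hY (pureExact_le_infPurFinite R _ hZ)

lemma supPurFinite_of_trW {X Y : K R} {s : X ⟶ Y} (hs : (pureExact R).trW s)
    (hX : supPurFinite R X) : supPurFinite R Y := by
  obtain ⟨Z, _, _, hT, hZ⟩ := hs
  exact (supPurFinite R).ext_of_isTriangulatedClosed₂ _ hT hX (pureExact_le_supPurFinite R _ hZ)

variable (R)

lemma isLeftResolving :
    IsLeftResolving (pureExact R) (bounded R) (minusPP R ⊓ infPurFinite R) where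
  le_leftOrthogonal := inf_le_left.trans (minusPP_le_leftOrthogonal R)
  le_leftResolved X hX := by
    obtain ⟨Q, s, hQ, hs⟩ := bounded_le_leftResolved_minusPP R X hX
    exact ⟨Q, s, ⟨hQ, infPurFinite_of_trW hs (bounded_le_infPurFinite R X hX)⟩, hs⟩
  exists_fac f hQ hY := exists_fac_truncGE f hQ.1 hQ.2 hY

lemma isRightResolving :
    IsRightResolving (pureExact R) (bounded R) (plusPI R ⊓ supPurFinite R) where
  le_rightOrthogonal := inf_le_left.trans (plusPI_le_rightOrthogonal R)
  le_rightResolved X hX := by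
    obtain ⟨Q, s, hQ, hs⟩ := bounded_le_rightResolved_plusPI R X hX
    exact ⟨Q, s, ⟨hQ, supPurFinite_of_trW hs (bounded_le_supPurFinite R X hX)⟩, hs⟩
  exists_fac f hX hQ := exists_fac_truncLE f hX hQ.1 hQ.2

end Resolutions

end

end PureDerived

theorem theorem3p6 (R : Type u) [Ring R] :
    PureDerived.TriangleEquivalent (PureDerived.DbPur R) (PureDerived.KMinusPbPP R) ∧
      PureDerived.TriangleEquivalent (PureDerived.DbPur R) (PureDerived.KPlusPbPI R) :=
  ⟨(PureDerived.isLeftResolving R).triangleEquivalent (PureDerived.DbPur.Q R),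
    (PureDerived.isRightResolving R).triangleEquivalent (PureDerived.DbPur.Q R)⟩
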